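/- For $n\in\mathbb{N}$ let $\mathrm{NCB}_n$ denote the set of non-crossing $B_n$-partitions, i.e. of partitions $\pi$ of $\{1,\dots,n,-1,\dots,-n\}$ such that (i) $B\in\pi$ if and only if $-B\in\pi$, (ii) at most one block $B\in\pi$ satisfies $B=-B$, and (iii) no two distinct blocks cross when the vertices of a regular $2n$-gon are labelled $1,\dots,n,-1,\dots,-n$ clockwise in this order. Ordered by refinement, $\mathrm{NCB}_n$ is a finite lattice; the rank of $\pi$ is $\mathrm{rk}(\pi)=n-\lfloor \#\pi/2\rfloor$, where $\#\pi$ is the number of blocks. An $M$-chain of a finite lattice $L$ is a maximal chain $d\subseteq L$ such that for every chain $c\subseteq L$ the sublattice generated by $c$ and $d$ is distributive; $L$ is supersolvable if it has an $M$-chain. An element $x\in L$ is left modular if $(y\vee x)\wedge z=y\vee(x\wedge z)$ for all $y\le z$ in $L$. **Theorem.** The lattice $\mathrm{NCB}_n$ is supersolvable if and only if $n\le 3$. Moreover, for $n\ge 4$ there is no left modular element of rank $2$ in $\mathrm{NCB}_n$, and $\mathrm{NCB}_n$ has no $M$-chain. -/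

import Mathlib

namespace NonCrossingB

/-- The set `{1, …, n, -1, …, -n}` of nonzero integers of absolute value at most `n`. -/
abbrev SignedSet (n : ℕ) : Type := ↥((Finset.Icc (-(n : ℤ)) (n : ℤ)).erase 0)

namespace SignedSet

/-- The involution `i ↦ -i` of `{1, …, n, -1, …, -n}`. -/
def neg {n : ℕ} (i : SignedSet n) : SignedSet n :=
  ⟨-i.1, by
    have h := i.2
    simp only [Finset.mem_erase, Finset.mem_Icc] at h ⊢
    omega⟩

/-- The position of a label among the vertices of the regular `2n`-gon, which are labelled
`1, …, n, -1, …, -n` clockwise in this order: `i ↦ i` if `i > 0` and `i ↦ n - i` if `i < 0`. -/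
def pos {n : ℕ} (i : SignedSet n) : ℤ :=
  if 0 < i.1 then i.1 else (n : ℤ) - i.1

theorem neg_neg {n : ℕ} (i : SignedSet n) : i.neg.neg = i :=
  Subtype.ext (by simp [neg])

/-- The set `-B = {-i : i ∈ B}`. -/
def negSet {n : ℕ} (B : Set (SignedSet n)) : Set (SignedSet n) := neg '' B

end SignedSet

open SignedSet

/-- A partition of `{1, …, n, -1, …, -n}`, given as the equivalence relation whose classes are
its blocks, is a `B_n`-partition if `B` is a block if and only if `-B` is, and if at most one
block `B` is a zero block, that is, satisfies `B = -B`. -/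
structure IsBPartition {n : ℕ} (π : Setoid (SignedSet n)) : Prop where
  neg_mem_iff : ∀ B : Set (SignedSet n), B ∈ π.classes ↔ negSet B ∈ π.classes
  zeroBlock_unique : ∀ B ∈ π.classes, ∀ B' ∈ π.classes, B = negSet B → B' = negSet B' → B = B'

/-- Two sets of vertices of the `2n`-gon cross if there are four vertices, in this order around
the polygon, that belong alternately to the one and to the other. -/
def Crossing {n : ℕ} (B B' : Set (SignedSet n)) : Prop :=
  ∃ a ∈ B, ∃ b ∈ B', ∃ c ∈ B, ∃ d ∈ B',
    (pos a < pos b ∧ pos b < pos c ∧ pos c < pos d) ∨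
    (pos b < pos a ∧ pos a < pos d ∧ pos d < pos c)

/-- A partition is non-crossing if no two distinct blocks cross. -/
def IsNonCrossing {n : ℕ} (π : Setoid (SignedSet n)) : Prop :=
  ∀ B ∈ π.classes, ∀ B' ∈ π.classes, B ≠ B' → ¬ Crossing B B'

theorem isBPartition_iff {n : ℕ} (π : Setoid (SignedSet n)) :
    IsBPartition π ↔
      (∀ a b, π a b → π a.neg b.neg) ∧ (∀ a b, π a a.neg → π b b.neg → π a b) := by
  have key : (∀ a b, π a b → π a.neg b.neg) →
      ∀ a, negSet {x | π x a} = {x | π x a.neg} := by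
    intro h a
    ext x
    constructor
    · rintro ⟨y, hy, rfl⟩
      exact h _ _ hy
    · intro hx
      refine ⟨x.neg, ?_, neg_neg x⟩
      have := h _ _ hx
      rwa [neg_neg] at this
  constructor
  · rintro ⟨h1, h2⟩
    have hneg : ∀ a b, π a b → π a.neg b.neg := by
      intro a b hab
      obtain ⟨y, hy⟩ := (h1 _).1 (π.mem_classes b)
      have ha : a.neg ∈ {x | π x y} := hy ▸ ⟨a, hab, rfl⟩
      have hb : b.neg ∈ {x | π x y} := hy ▸ ⟨b, π.refl b, rfl⟩
      exact π.trans ha (π.symm hb)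
    refine ⟨hneg, fun a b ha hb => ?_⟩
    have hz : ∀ c, π c c.neg → {x | π x c} = negSet {x | π x c} := by
      intro c hc
      rw [key hneg c]
      ext x
      exact ⟨fun hx => π.trans hx hc, fun hx => π.trans hx (π.symm hc)⟩
    have h := h2 _ (π.mem_classes a) _ (π.mem_classes b) (hz a ha) (hz b hb)
    have : a ∈ {x | π x b} := h ▸ π.refl a
    exact this
  · rintro ⟨hneg, hz⟩
    have hfwd : ∀ B : Set (SignedSet n), B ∈ π.classes → negSet B ∈ π.classes := by
      rintro _ ⟨a, rfl⟩
      rw [key hneg a]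
      exact π.mem_classes _
    have hinv : ∀ B : Set (SignedSet n), negSet (negSet B) = B := by
      intro B
      simp only [negSet, Set.image_image, neg_neg, Set.image_id']
    refine ⟨fun B => ⟨hfwd B, fun h => ?_⟩, ?_⟩
    · have := hfwd _ h
      rwa [hinv] at this
    · rintro _ ⟨a, rfl⟩ _ ⟨b, rfl⟩ ha hb
      have h' : ∀ c, {x | π x c} = negSet {x | π x c} → π c c.neg := by
        intro c hc
        have : c ∈ negSet {x | π x c} := hc ▸ π.refl c
        rwa [key hneg c] at this
      have hab := hz a b (h' a ha) (h' b hb)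
      ext x
      exact ⟨fun hx => π.trans hx hab, fun hx => π.trans hx (π.symm hab)⟩

theorem isNonCrossing_iff {n : ℕ} (π : Setoid (SignedSet n)) :
    IsNonCrossing π ↔ ∀ a b c d : SignedSet n, pos a < pos b → pos b < pos c → pos c < pos d →
      π a c → π b d → π a b := by
  constructor
  · intro h a b c d hab hbc hcd hac hbd
    by_contra hne
    refine h _ (π.mem_classes a) _ (π.mem_classes b) (fun he => hne ?_)
      ⟨a, π.refl a, b, π.refl b, c, π.symm hac, d, π.symm hbd, Or.inl ⟨hab, hbc, hcd⟩⟩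
    have : a ∈ {x | π x b} := he ▸ π.refl a
    exact this
  · rintro h _ ⟨u, rfl⟩ _ ⟨v, rfl⟩ hne ⟨a, ha, b, hb, c, hc, d, hd, ho⟩
    have hab : π a b := by
      rcases ho with ⟨h1, h2, h3⟩ | ⟨h1, h2, h3⟩
      · exact h a b c d h1 h2 h3 (π.trans ha (π.symm hc)) (π.trans hb (π.symm hd))
      · exact π.symm (h b a d c h1 h2 h3 (π.trans hb (π.symm hd)) (π.trans ha (π.symm hc)))
    have huv : π u v := π.trans (π.symm ha) (π.trans hab hb)
    apply hne
    ext x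
    exact ⟨fun hx => π.trans hx huv, fun hx => π.trans hx (π.symm huv)⟩

/-- `NCB n` is the set of non-crossing `B_n`-partitions. -/
def NCB (n : ℕ) : Type := {π : Setoid (SignedSet n) // IsBPartition π ∧ IsNonCrossing π}

namespace NCB

/-- The order is refinement: `π ≤ ρ` if every block of `π` is contained in a block of `ρ`. -/
instance (n : ℕ) : PartialOrder (NCB n) :=
  inferInstanceAs (PartialOrder {π : Setoid (SignedSet n) // IsBPartition π ∧ IsNonCrossing π})

instance (n : ℕ) : Finite (NCB n) := by
  have : Finite (Setoid (SignedSet n)) :=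
    Finite.of_injective (fun π : Setoid (SignedSet n) => fun a b => π a b)
      (fun π ρ h => Setoid.ext fun a b => iff_of_eq (congrFun (congrFun h a) b))
  exact inferInstanceAs
    (Finite {π : Setoid (SignedSet n) // IsBPartition π ∧ IsNonCrossing π})

/-- The intersection of non-crossing `B_n`-partitions. -/
instance (n : ℕ) : InfSet (NCB n) where
  sInf S := ⟨sInf (Subtype.val '' S), by
    rw [isBPartition_iff, isNonCrossing_iff]
    refine ⟨⟨?_, ?_⟩, ?_⟩
    · rintro a b h _ ⟨π, hπ, rfl⟩
      exact ((isBPartition_iff _).1 π.2.1).1 _ _ (h _ ⟨π, hπ, rfl⟩)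
    · rintro a b ha hb _ ⟨π, hπ, rfl⟩
      exact ((isBPartition_iff _).1 π.2.1).2 _ _ (ha _ ⟨π, hπ, rfl⟩) (hb _ ⟨π, hπ, rfl⟩)
    · rintro a b c d h1 h2 h3 hac hbd _ ⟨π, hπ, rfl⟩
      exact (isNonCrossing_iff _).1 π.2.2 a b c d h1 h2 h3
        (hac _ ⟨π, hπ, rfl⟩) (hbd _ ⟨π, hπ, rfl⟩)⟩

/-- The lattice of non-crossing `B_n`-partitions: meets are intersections, and the join is the
finest non-crossing `B_n`-partition that is refined by both partitions. -/
instance (n : ℕ) : CompleteLattice (NCB n) :=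
  completeLatticeOfInf (NCB n) fun S =>
    ⟨fun π hπ => sInf_le (a := π.1) ⟨π, hπ, rfl⟩,
      fun ρ hρ => le_sInf (a := ρ.1) (by rintro _ ⟨π, hπ, rfl⟩; exact hρ hπ)⟩

/-- The rank `n - ⌊#π / 2⌋`, where `#π` is the number of blocks of `π`. -/
noncomputable def rank {n : ℕ} (π : NCB n) : ℕ := n - π.1.classes.ncard / 2

end NCB

/-- An element `x` of a lattice is left modular if `(y ⊔ x) ⊓ z = y ⊔ (x ⊓ z)` for all
`y ≤ z`. -/
def IsLeftModular {L : Type*} [Lattice L] (x : L) : Prop :=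
  ∀ y z : L, y ≤ z → (y ⊔ x) ⊓ z = y ⊔ (x ⊓ z)

/-- An `M`-chain of a lattice is a maximal chain `d` such that for every chain `c` the sublattice
generated by `c` and `d` is distributive. -/
def IsMChain {L : Type*} [Lattice L] (d : Set L) : Prop :=
  IsMaxChain (· ≤ ·) d ∧
    ∀ c : Set L, IsChain (· ≤ ·) c →
      ∀ x ∈ latticeClosure (c ∪ d), ∀ y ∈ latticeClosure (c ∪ d), ∀ z ∈ latticeClosure (c ∪ d),
        x ⊓ (y ⊔ z) = (x ⊓ y) ⊔ (x ⊓ z)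

/-- A finite lattice is supersolvable if it has an `M`-chain. -/
def IsSupersolvable (L : Type*) [Lattice L] [Finite L] : Prop :=
  ∃ d : Set L, IsMChain d

end NonCrossingB

/-! Members of an M-chain are left modular (`IsMChain.isLeftModular`), so for `n ≥ 4` it suffices to
restrict left modular elements `x`. Four configurations of vertices each obstruct left modularity
(`not_isLeftModular_of_zero`, `_of_between`, `_of_triple`, `_of_two_pairs`). Consequently, if `x`
has a zero block, that block misses at most one pair `±a`, and the rank is at least `n - 1`. If `x`
has no zero block, it has at most one pair of nontrivial blocks, each with two elements, and the
rank is at most 1. For `n ≥ 4` this excludes rank 2.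

An M-chain is excluded without knowing that the lattice is graded. Take its largest member `u`
without zero block and its smallest member `v` with one. If `{p, q}` is the nontrivial block of `u`
up to sign, the partition with zero block `{±p, ±q}` lies between `u` and `v`, so by maximality it
belongs to the chain. It misses two pairs when `n ≥ 4`, hence is not left modular.

For `n ≤ 3` an M-chain of the form `⊥ ≤ a ≤ x ≤ ⊤` is exhibited. One inequality for descending
triples of elements suffices (`distributive_latticeClosure`). It is immediate in length at most two,
which covers `n ≤ 2`, and is a finite check for the hexagon. -/

namespace NonCrossingB

open SignedSet

/-! ### M-chains, left modularity and a criterion for short M-chains. -/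

section LatticeTheory

variable {L : Type*} [Lattice L]

/-- For `y ≤ z`, left modularity is the distributive law for `z ⊓ (y ⊔ x)`, applied with the chain
`{y, z}`. -/
theorem IsMChain.isLeftModular {d : Set L} (hd : IsMChain d) {x : L} (hx : x ∈ d) :
    IsLeftModular x := by
  intro y z hyz
  have hc : IsChain (· ≤ ·) ({y, z} : Set L) := by
    rintro u (rfl | rfl) v (rfl | rfl) h <;> simp_all
  have hsub := subset_latticeClosure (s := ({y, z} : Set L) ∪ d)
  have := hd.2 _ hc z (hsub (by simp)) y (hsub (by simp)) x (hsub (by simp [hx]))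
  rw [inf_comm, this, inf_eq_right.2 hyz, inf_comm]

/-- An element `x` is not left modular as soon as there are `y ≤ z` with `x ⊓ z ≤ y` such that
`(y ⊔ x) ⊓ z` is not below `y`. -/
theorem not_isLeftModular {x y z : L} (hyz : y ≤ z) (h : x ⊓ z ≤ y) (h' : ¬ (y ⊔ x) ⊓ z ≤ y) :
    ¬ IsLeftModular x := fun hx => h' (by rw [hx y z hyz]; exact sup_le le_rfl h)

theorem inf_sup_of_le_or {u v w : L} (h : v ≤ w ∨ w ≤ v) : u ⊓ (v ⊔ w) = u ⊓ v ⊔ u ⊓ w := by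
  rcases h with h | h
  · rw [sup_eq_right.2 h, sup_eq_right.2 (inf_le_inf_left u h)]
  · rw [sup_eq_left.2 h, sup_eq_left.2 (inf_le_inf_left u h)]

theorem sup_inf_of_le_or {u v w : L} (h : v ≤ w ∨ w ≤ v) : u ⊔ v ⊓ w = (u ⊔ v) ⊓ (u ⊔ w) := by
  rcases h with h | h
  · rw [inf_eq_left.2 h, inf_eq_left.2 (sup_le_sup_left h u)]
  · rw [inf_eq_right.2 h, inf_eq_right.2 (sup_le_sup_left h u)]

variable [BoundedOrder L]

/-- Two chains `⊥ ≤ a ≤ x ≤ ⊤` and `c` generate a distributive sublattice if the joins of meets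
of their elements are meets of joins. -/
theorem distributive_latticeClosure {a x : L} (hax : a ≤ x)
    (H : ∀ y₁ y₂ y₃ : L, y₃ ≤ y₂ → y₂ ≤ y₁ →
      y₁ ⊓ (a ⊔ y₂) ⊓ (x ⊔ y₃) ≤ a ⊓ y₁ ⊔ x ⊓ y₂ ⊔ y₃)
    {c : Set L} (hc : IsChain (· ≤ ·) c) :
    ∀ u ∈ latticeClosure (c ∪ {⊥, a, x, ⊤}), ∀ v ∈ latticeClosure (c ∪ {⊥, a, x, ⊤}),
      ∀ w ∈ latticeClosure (c ∪ {⊥, a, x, ⊤}), u ⊓ (v ⊔ w) = (u ⊓ v) ⊔ (u ⊓ w) := by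
  set C : Set L := insert ⊥ (insert ⊤ c) with hC
  have hcomp : ∀ u ∈ C, ∀ v ∈ C, u ≤ v ∨ v ≤ u := by
    rintro u (rfl | rfl | hu) v (rfl | rfl | hv) <;> first | exact hc.total hu hv | simp
  have hinf : ∀ u ∈ C, ∀ v ∈ C, u ⊓ v ∈ C := by
    intro u hu v hv
    rcases hcomp u hu v hv with h | h
    · rwa [inf_eq_left.2 h]
    · rwa [inf_eq_right.2 h]
  have hsup : ∀ u ∈ C, ∀ v ∈ C, u ⊔ v ∈ C := by
    intro u hu v hv
    rcases hcomp u hu v hv with h | h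
    · rwa [sup_eq_right.2 h]
    · rwa [sup_eq_left.2 h]
  -- Normal form for the generated sublattice. By `H` a descending triple gives the same element as
  -- a join of meets and as a meet of joins. Joins are componentwise by the first form and meets by
  -- the second, so the normal forms are a homomorphic image of a distributive lattice of triples.
  let f : L → L → L → L := fun y₁ y₂ y₃ => a ⊓ y₁ ⊔ x ⊓ y₂ ⊔ y₃
  have hf : ∀ y₁ y₂ y₃ : L, y₃ ≤ y₂ → y₂ ≤ y₁ → f y₁ y₂ y₃ = y₁ ⊓ (a ⊔ y₂) ⊓ (x ⊔ y₃) := by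
    intro y₁ y₂ y₃ h h'
    refine le_antisymm ?_ (H _ _ _ h h')
    refine sup_le (sup_le ?_ ?_) ?_
    · exact le_inf (le_inf inf_le_right (inf_le_left.trans le_sup_left))
        (inf_le_left.trans (hax.trans le_sup_left))
    · exact le_inf (le_inf (inf_le_right.trans h') (inf_le_right.trans le_sup_right))
        (inf_le_left.trans le_sup_left)
    · exact le_inf (le_inf (h.trans h') (h.trans le_sup_right)) le_sup_right
  have fsup : ∀ y₁ ∈ C, ∀ y₂ ∈ C, ∀ y₃ ∈ C, ∀ z₁ ∈ C, ∀ z₂ ∈ C, ∀ z₃ ∈ C,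
      f y₁ y₂ y₃ ⊔ f z₁ z₂ z₃ = f (y₁ ⊔ z₁) (y₂ ⊔ z₂) (y₃ ⊔ z₃) := by
    intro y₁ h₁ y₂ h₂ y₃ h₃ z₁ k₁ z₂ k₂ z₃ k₃
    simp only [f]
    rw [inf_sup_of_le_or (hcomp _ h₁ _ k₁), inf_sup_of_le_or (hcomp _ h₂ _ k₂)]
    ac_rfl
  have finf : ∀ y₁ ∈ C, ∀ y₂ ∈ C, ∀ y₃ ∈ C, ∀ z₁ ∈ C, ∀ z₂ ∈ C, ∀ z₃ ∈ C,
      y₃ ≤ y₂ → y₂ ≤ y₁ → z₃ ≤ z₂ → z₂ ≤ z₁ →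
      f y₁ y₂ y₃ ⊓ f z₁ z₂ z₃ = f (y₁ ⊓ z₁) (y₂ ⊓ z₂) (y₃ ⊓ z₃) := by
    intro y₁ h₁ y₂ h₂ y₃ h₃ z₁ k₁ z₂ k₂ z₃ k₃ e₁ e₂ e₃ e₄
    rw [hf _ _ _ e₁ e₂, hf _ _ _ e₃ e₄, hf _ _ _ (inf_le_inf e₁ e₃) (inf_le_inf e₂ e₄),
      sup_inf_of_le_or (hcomp _ h₂ _ k₂), sup_inf_of_le_or (hcomp _ h₃ _ k₃)]
    ac_rfl
  have hdist : ∀ u ∈ C, ∀ v ∈ C, ∀ w ∈ C, u ⊓ (v ⊔ w) = u ⊓ v ⊔ u ⊓ w :=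
    fun u _ v hv w hw => inf_sup_of_le_or (hcomp v hv w hw)
  let T : Set L := {u | ∃ y₁ ∈ C, ∃ y₂ ∈ C, ∃ y₃ ∈ C, y₃ ≤ y₂ ∧ y₂ ≤ y₁ ∧ f y₁ y₂ y₃ = u}
  have hbot : (⊥ : L) ∈ C := Or.inl rfl
  have htop : (⊤ : L) ∈ C := Or.inr (Or.inl rfl)
  have hT : IsSublattice T := by
    constructor
    · rintro _ ⟨y₁, h₁, y₂, h₂, y₃, h₃, e₁, e₂, rfl⟩ _ ⟨z₁, k₁, z₂, k₂, z₃, k₃, e₃, e₄, rfl⟩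
      exact ⟨_, hsup _ h₁ _ k₁, _, hsup _ h₂ _ k₂, _, hsup _ h₃ _ k₃, sup_le_sup e₁ e₃,
        sup_le_sup e₂ e₄, (fsup _ h₁ _ h₂ _ h₃ _ k₁ _ k₂ _ k₃).symm⟩
    · rintro _ ⟨y₁, h₁, y₂, h₂, y₃, h₃, e₁, e₂, rfl⟩ _ ⟨z₁, k₁, z₂, k₂, z₃, k₃, e₃, e₄, rfl⟩
      exact ⟨_, hinf _ h₁ _ k₁, _, hinf _ h₂ _ k₂, _, hinf _ h₃ _ k₃, inf_le_inf e₁ e₃,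
        inf_le_inf e₂ e₄, (finf _ h₁ _ h₂ _ h₃ _ k₁ _ k₂ _ k₃ e₁ e₂ e₃ e₄).symm⟩
  have hsubset : latticeClosure (c ∪ {⊥, a, x, ⊤}) ⊆ T := by
    refine latticeClosure_min ?_ hT
    have hmem : ∀ y ∈ C, y ∈ T := fun y hy => ⟨y, hy, y, hy, y, hy, le_rfl, le_rfl,
      sup_eq_right.2 (sup_le inf_le_right inf_le_right)⟩
    rintro u (hu | rfl | rfl | rfl | rfl)
    · exact hmem u (Or.inr (Or.inr hu))
    · exact hmem _ hbot
    · exact ⟨⊤, htop, ⊥, hbot, ⊥, hbot, le_rfl, bot_le, by simp [f]⟩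
    · exact ⟨⊤, htop, ⊤, htop, ⊥, hbot, bot_le, le_rfl, by simpa [f] using hax⟩
    · exact hmem _ htop
  intro u hu v hv w hw
  obtain ⟨y₁, h₁, y₂, h₂, y₃, h₃, e₁, e₂, rfl⟩ := hsubset hu
  obtain ⟨z₁, k₁, z₂, k₂, z₃, k₃, e₃, e₄, rfl⟩ := hsubset hv
  obtain ⟨t₁, l₁, t₂, l₂, t₃, l₃, e₅, e₆, rfl⟩ := hsubset hw
  rw [fsup _ k₁ _ k₂ _ k₃ _ l₁ _ l₂ _ l₃,
    finf _ h₁ _ h₂ _ h₃ _ (hsup _ k₁ _ l₁) _ (hsup _ k₂ _ l₂) _ (hsup _ k₃ _ l₃) e₁ e₂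
      (sup_le_sup e₃ e₅) (sup_le_sup e₄ e₆),
    finf _ h₁ _ h₂ _ h₃ _ k₁ _ k₂ _ k₃ e₁ e₂ e₃ e₄,
    finf _ h₁ _ h₂ _ h₃ _ l₁ _ l₂ _ l₃ e₁ e₂ e₅ e₆,
    fsup _ (hinf _ h₁ _ k₁) _ (hinf _ h₂ _ k₂) _ (hinf _ h₃ _ k₃) _ (hinf _ h₁ _ l₁) _
      (hinf _ h₂ _ l₂) _ (hinf _ h₃ _ l₃),
    hdist _ h₁ _ k₁ _ l₁, hdist _ h₂ _ k₂ _ l₂, hdist _ h₃ _ k₃ _ l₃]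

theorem isMaxChain_of_wcovBy {a x : L} (h₁ : ⊥ ⩿ a) (h₂ : a ⩿ x) (h₃ : x ⩿ ⊤) :
    IsMaxChain (· ≤ ·) ({⊥, a, x, ⊤} : Set L) := by
  constructor
  · rintro u (rfl | rfl | rfl | rfl) v (rfl | rfl | rfl | rfl) - <;> simp [h₂.le]
  · intro t ht hsub
    refine hsub.antisymm fun u hu => ?_
    have ha : a ∈ t := hsub (by simp)
    have hx : x ∈ t := hsub (by simp)
    simp only [Set.mem_insert_iff, Set.mem_singleton_iff]
    rcases ht.total hu ha with h | h
    · rcases h₁.eq_or_eq bot_le h with h | h <;> simp [h]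
    · rcases ht.total hu hx with h' | h'
      · rcases h₂.eq_or_eq h h' with h | h <;> simp [h]
      · rcases h₃.eq_or_eq h' le_top with h | h <;> simp [h]

theorem isSupersolvable_of_wcovBy [Finite L] {a x : L} (h₁ : ⊥ ⩿ a) (h₂ : a ⩿ x) (h₃ : x ⩿ ⊤)
    (H : ∀ y₁ y₂ y₃ : L, y₃ ≤ y₂ → y₂ ≤ y₁ →
      y₁ ⊓ (a ⊔ y₂) ⊓ (x ⊔ y₃) ≤ a ⊓ y₁ ⊔ x ⊓ y₂ ⊔ y₃) :
    IsSupersolvable L :=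
  ⟨_, isMaxChain_of_wcovBy h₁ h₂ h₃, fun _ hc => distributive_latticeClosure h₂.le H hc⟩

/-- A lattice of length at most two is supersolvable. -/
theorem isSupersolvable_of_length_le_two [Finite L]
    (h : ∀ u v : L, u < v → u = ⊥ ∨ v = ⊤) : IsSupersolvable L := by
  obtain ⟨a, h₁, h₂⟩ : ∃ a : L, ⊥ ⩿ a ∧ a ⩿ ⊤ := by
    by_cases h0 : ∃ a : L, a ≠ ⊥ ∧ a ≠ ⊤
    · obtain ⟨a, ha, ha'⟩ := h0
      refine ⟨a, ⟨bot_le, fun c hc hca => ?_⟩, ⟨le_top, fun c hc hct => ?_⟩⟩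
      · exact (h c a hca).elim hc.ne' ha'
      · exact (h a c hc).elim ha hct.ne
    · push Not at h0
      exact ⟨⊥, WCovBy.rfl, bot_le, fun c hc hct => hct.ne (h0 c hc.ne')⟩
  refine isSupersolvable_of_wcovBy h₁ h₂ WCovBy.rfl fun y₁ y₂ y₃ h₃ h₄ => ?_
  rcases h₄.eq_or_lt with rfl | h₄
  · exact le_sup_of_le_left (le_sup_of_le_right (le_inf le_top (inf_le_left.trans inf_le_left)))
  · rcases h _ _ h₄ with rfl | rfl
    · simp [inf_comm]
    · simp

end LatticeTheory

/-! ### Positions on the polygon. -/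

namespace SignedSet

variable {n : ℕ}

theorem abs_bound (i : SignedSet n) : i.1 ≠ 0 ∧ -(n : ℤ) ≤ i.1 ∧ i.1 ≤ n := by
  simpa only [Finset.mem_erase, Finset.mem_Icc] using i.2

theorem pos_bounds (i : SignedSet n) : 1 ≤ pos i ∧ pos i ≤ 2 * n := by
  have := abs_bound i
  unfold pos
  split_ifs <;> omega

/-- Negation is the half-turn of the polygon; with this, most geometric claims reduce to linear
arithmetic on positions. -/
theorem pos_neg (i : SignedSet n) :
    (pos i ≤ n ∧ pos i.neg = pos i + n) ∨ (n < pos i ∧ pos i.neg = pos i - n) := by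
  have := abs_bound i
  have h : i.neg.1 = -i.1 := rfl
  unfold pos
  rw [h]
  split_ifs <;> omega

theorem eq_of_pos_eq {i j : SignedSet n} (h : pos i = pos j) : i = j := by
  have := abs_bound i
  have := abs_bound j
  unfold pos at h
  apply Subtype.ext
  split_ifs at h <;> omega

theorem pos_eq_iff {i j : SignedSet n} : i = j ↔ pos i = pos j :=
  ⟨fun h => h ▸ rfl, eq_of_pos_eq⟩

theorem neg_ne (i : SignedSet n) : i.neg ≠ i := by
  have := abs_bound i
  intro h
  have h : -i.1 = i.1 := congrArg Subtype.val h
  omega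

theorem neg_eq_iff {i j : SignedSet n} : i.neg = j ↔ i = j.neg :=
  ⟨fun h => by rw [← h, neg_neg], fun h => by rw [h, neg_neg]⟩

end SignedSet

/-! ### Partitions as relations, and constructions of partitions. -/

namespace NCB

variable {n : ℕ}

theorem rel_neg (w : NCB n) {a b : SignedSet n} (h : w.1 a b) : w.1 a.neg b.neg :=
  ((isBPartition_iff _).1 w.2.1).1 a b h

theorem rel_neg_iff (w : NCB n) {a b : SignedSet n} : w.1 a.neg b.neg ↔ w.1 a b :=
  ⟨fun h => by simpa only [neg_neg] using w.rel_neg h, w.rel_neg⟩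

theorem rel_of_zero (w : NCB n) {a b : SignedSet n} (ha : w.1 a a.neg) (hb : w.1 b b.neg) :
    w.1 a b :=
  ((isBPartition_iff _).1 w.2.1).2 a b ha hb

/-- Crossing is a cyclic condition, while `isNonCrossing_iff` treats one linear order. The eight
cases are the linear orders in which `a, c` and `b, d` alternate. -/
theorem rel_of_crossing (w : NCB n) {a b c d : SignedSet n} (hac : w.1 a c) (hbd : w.1 b d)
    (h : pos a < pos b ∧ pos b < pos c ∧ (pos c < pos d ∨ pos d < pos a) ∨
      pos c < pos b ∧ pos b < pos a ∧ (pos a < pos d ∨ pos d < pos c) ∨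
      pos a < pos d ∧ pos d < pos c ∧ (pos c < pos b ∨ pos b < pos a) ∨
      pos c < pos d ∧ pos d < pos a ∧ (pos a < pos b ∨ pos b < pos c)) : w.1 a b := by
  have key := (isNonCrossing_iff _).1 w.2.2
  have hca := w.1.symm hac
  have hdb := w.1.symm hbd
  rcases h with ⟨h₁, h₂, h₃ | h₃⟩ | ⟨h₁, h₂, h₃ | h₃⟩ | ⟨h₁, h₂, h₃ | h₃⟩ | ⟨h₁, h₂, h₃ | h₃⟩
  · exact key a b c d h₁ h₂ h₃ hac hbd
  · exact w.1.symm (w.1.trans hbd (key d a b c h₃ h₁ h₂ hdb hac))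
  · exact w.1.trans hac (key c b a d h₁ h₂ h₃ hca hbd)
  · exact w.1.symm (w.1.trans hbd (w.1.trans (key d c b a h₃ h₁ h₂ hdb hca) hca))
  · exact w.1.trans (key a d c b h₁ h₂ h₃ hac hdb) hdb
  · exact w.1.symm (key b a d c h₃ h₁ h₂ hbd hac)
  · exact w.1.trans hac (w.1.trans (key c d a b h₁ h₂ h₃ hca hdb) hdb)
  · exact w.1.symm (w.1.trans (key b c d a h₃ h₁ h₂ hbd hca) hca)

theorem le_iff {u v : NCB n} : u ≤ v ↔ ∀ a b, u.1 a b → v.1 a b :=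
  ⟨fun h _ _ hab => h hab, fun h _ _ hab => h _ _ hab⟩

theorem inf_rel {u v : NCB n} {a b : SignedSet n} : (u ⊓ v).1 a b ↔ u.1 a b ∧ v.1 a b := by
  refine ⟨fun h => ⟨le_iff.1 inf_le_left _ _ h, le_iff.1 inf_le_right _ _ h⟩, fun h => ?_⟩
  rintro _ ⟨π, hπ, rfl⟩
  rcases hπ with rfl | hπ
  · exact h.1
  · obtain rfl : π = v := hπ
    exact h.2

/-- The join of `x` and `y` is never computed: a relation forced in every common upper bound `w` is
enough. -/
theorem not_isLeftModular_of_rel {x y z : NCB n} (hyz : ∀ a b, y.1 a b → z.1 a b)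
    (h : ∀ a b, x.1 a b → z.1 a b → y.1 a b) {p q : SignedSet n} (hz : z.1 p q) (hy : ¬ y.1 p q)
    (hw : ∀ w : NCB n, x ≤ w → y ≤ w → w.1 p q) : ¬ IsLeftModular x :=
  not_isLeftModular (le_iff.2 hyz) (le_iff.2 fun a b hab => h a b (inf_rel.1 hab).1 (inf_rel.1 hab).2)
    fun h' => hy (le_iff.1 h' _ _ (inf_rel.2 ⟨hw _ le_sup_right le_sup_left, hz⟩))

/-- The non-crossing `B_n`-partition whose blocks are the members of a family of sets, and
singletons otherwise. -/
def ofBlocks {ι : Type*} (B : ι → Set (SignedSet n))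
    (disj : ∀ s t p, p ∈ B s → p ∈ B t → s = t)
    (hneg : ∀ s, ∃ t, ∀ p ∈ B s, p.neg ∈ B t)
    (zero : ∀ s t p q, p ∈ B s → p.neg ∈ B s → q ∈ B t → q.neg ∈ B t → s = t)
    (nc : ∀ s t, ∀ a ∈ B s, ∀ b ∈ B t, ∀ c ∈ B s, ∀ d ∈ B t,
      pos a < pos b → pos b < pos c → pos c < pos d → s = t) : NCB n :=
  ⟨{ r := fun p q => p = q ∨ ∃ s, p ∈ B s ∧ q ∈ B s
     iseqv := by
      refine ⟨fun p => Or.inl rfl, ?_, ?_⟩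
      · rintro p q (rfl | ⟨s, h, h'⟩)
        · exact Or.inl rfl
        · exact Or.inr ⟨s, h', h⟩
      · rintro p q r (rfl | ⟨s, h, h'⟩) (rfl | ⟨t, k, k'⟩)
        · exact Or.inl rfl
        · exact Or.inr ⟨t, k, k'⟩
        · exact Or.inr ⟨s, h, h'⟩
        · obtain rfl := disj _ _ _ h' k
          exact Or.inr ⟨s, h, k'⟩ }, by
    rw [isBPartition_iff, isNonCrossing_iff]
    refine ⟨⟨?_, ?_⟩, ?_⟩
    · rintro p q (rfl | ⟨s, h, h'⟩)
      · exact Or.inl rfl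
      · obtain ⟨t, ht⟩ := hneg s
        exact Or.inr ⟨t, ht _ h, ht _ h'⟩
    · rintro p q (h | ⟨s, h, h'⟩) (k | ⟨t, k, k'⟩)
      · exact absurd h.symm (neg_ne p)
      · exact absurd h.symm (neg_ne p)
      · exact absurd k.symm (neg_ne q)
      · obtain rfl := zero s t p q h h' k k'
        exact Or.inr ⟨s, h, k⟩
    · rintro a b c d hab hbc hcd (rfl | ⟨s, h, h'⟩) (rfl | ⟨t, k, k'⟩)
      · omega
      · omega
      · omega
      · obtain rfl := nc s t a h b k c h' d k' hab hbc hcd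
        exact Or.inr ⟨s, h, k⟩⟩

/-- The partition whose only nontrivial block is the set `S = -S`. -/
def zeroBlock (S : Set (SignedSet n)) (hS : ∀ p ∈ S, p.neg ∈ S) : NCB n :=
  ofBlocks (fun _ : Unit => S) (fun _ _ _ _ _ => rfl) (fun s => ⟨s, hS⟩)
    (fun _ _ _ _ _ _ _ _ => rfl) (fun _ _ _ _ _ _ _ _ _ _ _ _ _ => rfl)

theorem zeroBlock_rel {S : Set (SignedSet n)} {hS : ∀ p ∈ S, p.neg ∈ S} {p q : SignedSet n} :
    (zeroBlock S hS).1 p q ↔ p = q ∨ p ∈ S ∧ q ∈ S :=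
  ⟨fun h => h.imp_right fun ⟨_, h⟩ => h, fun h => h.imp_right fun h => ⟨(), h⟩⟩

/-- The partition whose nontrivial blocks are the members of a non-crossing family of sets
contained in a half of the polygon, and their negatives. -/
def ofHalf {ι : Type*} (B : ι → Set (SignedSet n)) (m : ℤ)
    (hm : ∀ s, ∀ p ∈ B s, m ≤ pos p ∧ pos p < m + n)
    (disj : ∀ s t p, p ∈ B s → p ∈ B t → s = t)
    (nc : ∀ s t, ∀ a ∈ B s, ∀ b ∈ B t, ∀ c ∈ B s, ∀ d ∈ B t,
      pos a < pos b → pos b < pos c → pos c < pos d → s = t) : NCB n := by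
  have hopp : ∀ s t p, p ∈ B s → p.neg ∈ B t → False := fun s t p h h' => by
    have := hm s p h
    have := hm t _ h'
    have := pos_neg p
    omega
  refine ofBlocks (fun s : ι × Bool => {p | (if s.2 then p else p.neg) ∈ B s.1}) ?_ ?_ ?_ ?_
  · rintro ⟨s, _ | _⟩ ⟨t, _ | _⟩ p h h' <;>
      simp only [Set.mem_ofPred_eq, if_true, if_false, Bool.false_eq_true] at h h'
    · rw [disj s t _ h h']
    · exact (hopp t s p h' h).elim
    · exact (hopp s t p h h').elim
    · rw [disj s t _ h h']
  · rintro ⟨s, e⟩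
    refine ⟨(s, !e), fun p h => ?_⟩
    cases e <;> simpa [neg_neg] using h
  · rintro ⟨s, _ | _⟩ t p q h h' - - <;>
      simp only [Set.mem_ofPred_eq, if_true, if_false, Bool.false_eq_true] at h h'
    · exact (hopp s s _ h h').elim
    · exact (hopp s s _ h h').elim
  · rintro ⟨s, _ | _⟩ ⟨t, _ | _⟩ a ha b hb c hc d hd h₁ h₂ h₃ <;>
      simp only [Set.mem_ofPred_eq, if_true, if_false, Bool.false_eq_true] at ha hb hc hd
    all_goals
      have ha' := hm _ _ ha
      have hb' := hm _ _ hb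
      have hc' := hm _ _ hc
      have hd' := hm _ _ hd
      have na := pos_neg a
      have pa := pos_bounds a
      have pd := pos_bounds d
      have nb := pos_neg b
      have nc' := pos_neg c
      have nd := pos_neg d
    -- Both blocks are negatives. The half-turn permutes `a, b, c, d` cyclically, and the cases say
    -- how many of them pass the end of the numbering.
    · by_cases e₁ : pos d ≤ n
      · rw [nc s t _ ha _ hb _ hc _ hd (by omega) (by omega) (by omega)]
      by_cases e₂ : pos c ≤ n
      · rw [nc t s _ hd _ ha _ hb _ hc (by omega) (by omega) (by omega)]
      by_cases e₃ : pos b ≤ n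
      · rw [nc s t _ hc _ hd _ ha _ hb (by omega) (by omega) (by omega)]
      by_cases e₄ : pos a ≤ n
      · rw [nc t s _ hb _ hc _ hd _ ha (by omega) (by omega) (by omega)]
      · rw [nc s t _ ha _ hb _ hc _ hd (by omega) (by omega) (by omega)]
    -- A block of the family and a negative one lie in complementary arcs, so they cannot alternate.
    · omega
    · omega
    · rw [nc s t _ ha _ hb _ hc _ hd h₁ h₂ h₃]

theorem ofHalf_rel {ι : Type*} {B : ι → Set (SignedSet n)} {m : ℤ}
    {hm : ∀ s, ∀ p ∈ B s, m ≤ pos p ∧ pos p < m + n}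
    {disj : ∀ s t p, p ∈ B s → p ∈ B t → s = t}
    {nc : ∀ s t, ∀ a ∈ B s, ∀ b ∈ B t, ∀ c ∈ B s, ∀ d ∈ B t,
      pos a < pos b → pos b < pos c → pos c < pos d → s = t} {p q : SignedSet n} :
    (ofHalf B m hm disj nc).1 p q ↔
      p = q ∨ ∃ s, p ∈ B s ∧ q ∈ B s ∨ p.neg ∈ B s ∧ q.neg ∈ B s := by
  refine or_congr_right ⟨?_, ?_⟩
  · rintro ⟨⟨s, _ | _⟩, h⟩
    · exact ⟨s, Or.inr h⟩
    · exact ⟨s, Or.inl h⟩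
  · rintro ⟨s, h | h⟩
    · exact ⟨(s, true), h⟩
    · exact ⟨(s, false), h⟩

/-- The partition whose only nontrivial blocks are `S` and `-S`, where `S` is contained in a half
of the polygon. -/
def pairBlock (S : Set (SignedSet n)) (m : ℤ) (hm : ∀ p ∈ S, m ≤ pos p ∧ pos p < m + n) : NCB n :=
  ofHalf (fun _ : Unit => S) m (fun _ => hm) (fun _ _ _ _ _ => rfl)
    (fun _ _ _ _ _ _ _ _ _ _ _ _ _ => rfl)

theorem pairBlock_rel {S : Set (SignedSet n)} {m : ℤ}
    {hm : ∀ p ∈ S, m ≤ pos p ∧ pos p < m + n} {p q : SignedSet n} :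
    (pairBlock S m hm).1 p q ↔ p = q ∨ p ∈ S ∧ q ∈ S ∨ p.neg ∈ S ∧ q.neg ∈ S :=
  ofHalf_rel.trans (by simp)

/-! ### Four configurations that obstruct left modularity. -/

variable {x : NCB n}

/-- The chord from `k` to `a` crosses the diameter from `i` to `-i`. So joining `{k, a}` to `x`
forces `k` and `i` together, while inside `{k, i, a}` the relation of `x` can only join `k` to `a`.
-/
theorem not_isLeftModular_of_zero {i k a : SignedSet n} (hi : x.1 i i.neg) (hk : ¬ x.1 k i)
    (ha : ¬ x.1 a i) (h₁ : pos k < pos i) (h₂ : pos i < pos a) (h₃ : pos a < pos k + n) :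
    ¬ IsLeftModular x := by
  have ni := pos_neg i
  have nk := pos_neg k
  have bi := pos_bounds i
  have bk := pos_bounds k
  let y : NCB n := pairBlock {k, a} (pos k) (by rintro p (rfl | rfl) <;> omega)
  let z : NCB n := pairBlock {k, i, a} (pos k) (by rintro p (rfl | rfl | rfl) <;> omega)
  have hy : ∀ p q, y.1 p q ↔ _ := fun p q => pairBlock_rel
  have hz : ∀ p q, z.1 p q ↔ _ := fun p q => pairBlock_rel
  have key : ∀ p ∈ ({k, i, a} : Set (SignedSet n)), ∀ q ∈ ({k, i, a} : Set (SignedSet n)),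
      x.1 p q → y.1 p q := by
    rintro p (rfl | rfl | rfl) q (rfl | rfl | rfl) h
    all_goals first
      | exact y.1.refl _
      | exact absurd h ‹_›
      | exact absurd (x.1.symm h) ‹_›
      | exact (hy _ _).2 (by simp)
  refine not_isLeftModular_of_rel (x := x) (y := y) (z := z) (p := k) (q := i) ?_ ?_ ?_ ?_ ?_
  · intro p q h
    rw [hy] at h
    rw [hz]
    refine h.imp_right (Or.imp (And.imp ?_ ?_) (And.imp ?_ ?_)) <;>
      · rintro (h | h) <;> simp [h]
  · intro p q h h'
    rcases (hz p q).1 h' with rfl | ⟨hp, hq⟩ | ⟨hp, hq⟩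
    · exact y.1.refl _
    · exact key p hp q hq h
    · exact y.rel_neg_iff.1 (key _ hp _ hq (x.rel_neg h))
  · exact (hz _ _).2 (by simp)
  · rw [hy]
    simp only [Set.mem_insert_iff, Set.mem_singleton_iff, pos_eq_iff]
    omega
  · intro w hxw hyw
    have hka : w.1 k a := hyw ((hy _ _).2 (by simp))
    exact w.rel_of_crossing hka (hxw hi) (by omega)

/-- The chord from `i` to `j` crosses the diameter at `l`. Joining the zero block `{±l}` to `x`
therefore absorbs `j`, although `x` relates no two distinct elements of `{±l, ±j}`. -/
theorem not_isLeftModular_of_between (hx : ∀ p, ¬ x.1 p p.neg) {i j l : SignedSet n}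
    (hij : x.1 i j) (hil : ¬ x.1 i l) (h₁ : pos i < pos l) (h₂ : pos l < pos j)
    (h₃ : pos j < pos i + n) : ¬ IsLeftModular x := by
  have nl := pos_neg l
  have nj := pos_neg j
  have bl := pos_bounds l
  have bj := pos_bounds j
  have bi := pos_bounds i
  have hlj : ¬ x.1 l j := fun h => hil (x.1.trans hij (x.1.symm h))
  have hlj' : ¬ x.1 l j.neg := fun h => hil (x.rel_of_crossing hij h (by omega))
  have hlj'' : ¬ x.1 l.neg j := fun h => hlj' (x.rel_neg_iff.1 (by rwa [neg_neg]))
  have hlj''' : ¬ x.1 l.neg j.neg := fun h => hlj (x.rel_neg_iff.1 h)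
  let y : NCB n := zeroBlock {l, l.neg} (by rintro p (rfl | rfl) <;> simp [neg_neg])
  let z : NCB n := zeroBlock {l, l.neg, j, j.neg}
    (by rintro p (rfl | rfl | rfl | rfl) <;> simp [neg_neg])
  have hy : ∀ p q, y.1 p q ↔ _ := fun p q => zeroBlock_rel
  have hz : ∀ p q, z.1 p q ↔ _ := fun p q => zeroBlock_rel
  refine not_isLeftModular_of_rel (x := x) (y := y) (z := z) (p := l) (q := j) ?_ ?_ ?_ ?_ ?_
  · intro p q h
    rw [hy] at h
    rw [hz]
    refine h.imp_right (And.imp ?_ ?_) <;>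
      · rintro (rfl | rfl) <;> simp
  · intro p q h h'
    rcases (hz p q).1 h' with rfl | ⟨rfl | rfl | rfl | rfl, rfl | rfl | rfl | rfl⟩
    all_goals first
      | exact y.1.refl _
      | exact absurd h ‹_›
      | exact absurd (x.1.symm h) ‹_›
      | exact absurd h (hx _)
      | exact absurd (x.1.symm h) (hx _)
  · exact (hz _ _).2 (by simp)
  · rw [hy]
    simp only [Set.mem_insert_iff, Set.mem_singleton_iff, pos_eq_iff]
    omega
  · intro w hxw hyw
    have hl : w.1 l l.neg := hyw ((hy _ _).2 (by simp))
    exact w.1.trans (w.1.symm (w.rel_of_crossing (hxw hij) hl (by omega))) (hxw hij)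

/-- A zero block at `±j` merges the block of `i, j, k` with its negative, hence `k` with `-i`. The
pair `{k, -i}` lies on one side of the diameter at `j`, so `z` can contain it as a separate block.
-/
theorem not_isLeftModular_of_triple (hx : ∀ p, ¬ x.1 p p.neg) {i j k : SignedSet n}
    (hij : x.1 i j) (hjk : x.1 j k) (h₁ : pos i < pos j) (h₂ : pos j < pos k)
    (h₃ : pos k < pos i + n) : ¬ IsLeftModular x := by
  have ni := pos_neg i
  have nj := pos_neg j
  have nk := pos_neg k
  have bi := pos_bounds i
  have bj := pos_bounds j
  have bk := pos_bounds k
  have hki : ¬ x.1 k i.neg := fun h => hx i (x.1.trans (x.1.trans hij hjk) h)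
  have hki' : ¬ x.1 k.neg i := fun h => hki (x.rel_neg_iff.1 (by rwa [neg_neg]))
  let y : NCB n := zeroBlock {j, j.neg} (by rintro p (rfl | rfl) <;> simp [neg_neg])
  let B : Fin 3 → Set (SignedSet n) := ![{j, j.neg}, {k, i.neg}, {k.neg, i}]
  let z : NCB n := ofBlocks B
    (by
      intro s t p hs ht
      fin_cases s <;> fin_cases t <;> first
        | rfl
        | exfalso
          simp only [B, Set.mem_insert_iff, Set.mem_singleton_iff, pos_eq_iff, Fin.reduceFinMk,
            Fin.zero_eta, Fin.mk_one, Matrix.cons_val] at hs ht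
          omega)
    (by
      intro s
      fin_cases s
      · exact ⟨0, by rintro p (rfl | rfl) <;> simp [B, neg_neg]⟩
      · exact ⟨2, by rintro p (rfl | rfl) <;> simp [B, neg_neg]⟩
      · exact ⟨1, by rintro p (rfl | rfl) <;> simp [B, neg_neg]⟩)
    (by
      have : ∀ s p, p ∈ B s → p.neg ∈ B s → s = 0 := by
        intro s p hp hp'
        have np := pos_neg p
        fin_cases s
        · rfl
        all_goals
          exfalso
          simp only [B, Set.mem_insert_iff, Set.mem_singleton_iff, pos_eq_iff, Fin.reduceFinMk,
            Fin.mk_one, Matrix.cons_val] at hp hp'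
          omega
      intro s t p q h h' k k'
      rw [this s p h h', this t q k k'])
    (by
      intro s t a ha b hb c hc d hd hab hbc hcd
      fin_cases s <;> fin_cases t <;> first
        | rfl
        | exfalso
          simp only [B, Set.mem_insert_iff, Set.mem_singleton_iff, pos_eq_iff, Fin.reduceFinMk,
            Fin.zero_eta, Fin.mk_one, Matrix.cons_val] at ha hb hc hd
          omega)
  have hy : ∀ p q, y.1 p q ↔ _ := fun p q => zeroBlock_rel
  refine not_isLeftModular_of_rel (x := x) (y := y) (z := z) (p := k) (q := i.neg) ?_ ?_ ?_ ?_ ?_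
  · intro p q h
    rw [hy] at h
    exact h.imp_right fun h => ⟨0, h⟩
  · rintro p q h (rfl | ⟨s, hp, hq⟩)
    · exact y.1.refl _
    · fin_cases s <;> rcases hp with rfl | rfl <;> rcases hq with rfl | rfl
      all_goals first
        | exact y.1.refl _
        | exact absurd h ‹_›
        | exact absurd (x.1.symm h) ‹_›
        | exact (hy _ _).2 (by simp)
  · exact Or.inr ⟨1, by simp [B]⟩
  · rw [hy]
    simp only [Set.mem_insert_iff, Set.mem_singleton_iff, pos_eq_iff]
    omega
  · intro w hxw hyw
    have hj : w.1 j j.neg := hyw ((hy _ _).2 (by simp))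
    exact w.1.trans (w.1.symm (hxw hjk)) (w.1.trans hj (w.rel_neg (w.1.symm (hxw hij))))

/-- Joining `j` to `k` links `i, j, k, l` in one block, but `{i, l}` can be nested around `{j, k}`
as a separate block of `z`. -/
theorem not_isLeftModular_of_two_pairs {i j k l : SignedSet n}
    (hij : x.1 i j) (hkl : x.1 k l) (hik : ¬ x.1 i k) (h₁ : pos i < pos j) (h₂ : pos j < pos k)
    (h₃ : pos k < pos l) (h₄ : pos l < pos i + n) : ¬ IsLeftModular x := by
  have ni := pos_neg i
  have nl := pos_neg l
  have bi := pos_bounds i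
  have hil : ¬ x.1 i l := fun h => hik (x.1.trans h (x.1.symm hkl))
  let y : NCB n := pairBlock {j, k} (pos i) (by rintro p (rfl | rfl) <;> omega)
  let B : Bool → Set (SignedSet n) := fun s => if s then {j, k} else {i, l}
  let z : NCB n := ofHalf B (pos i)
    (by rintro (_ | _) p (rfl | rfl) <;> omega)
    (by
      rintro (_ | _) (_ | _) p hs ht <;> first
        | rfl
        | exfalso
          simp only [B, Set.mem_insert_iff, Set.mem_singleton_iff, pos_eq_iff, if_true, if_false,
            Bool.false_eq_true] at hs ht
          omega)
    (by
      rintro (_ | _) (_ | _) a ha b hb c hc d hd hab hbc hcd <;> first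
        | rfl
        | exfalso
          simp only [B, Set.mem_insert_iff, Set.mem_singleton_iff, pos_eq_iff, if_true, if_false,
            Bool.false_eq_true] at ha hb hc hd
          omega)
  have hy : ∀ p q, y.1 p q ↔ _ := fun p q => pairBlock_rel
  have hz : ∀ p q, z.1 p q ↔ _ := fun p q => ofHalf_rel
  have key : ∀ s, ∀ p ∈ B s, ∀ q ∈ B s, x.1 p q → y.1 p q := by
    rintro (_ | _) p hp q hq h
    · obtain rfl | rfl := hp <;> obtain rfl | rfl := hq
      all_goals first
        | exact y.1.refl _
        | exact absurd h ‹_›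
        | exact absurd (x.1.symm h) ‹_›
    · exact (hy _ _).2 (Or.inr (Or.inl ⟨hp, hq⟩))
  refine not_isLeftModular_of_rel (x := x) (y := y) (z := z) (p := i) (q := l) ?_ ?_ ?_ ?_ ?_
  · intro p q h
    rw [hy] at h
    rw [hz]
    exact h.imp_right fun h => ⟨true, h⟩
  · intro p q h h'
    rcases (hz p q).1 h' with rfl | ⟨s, ⟨hp, hq⟩ | ⟨hp, hq⟩⟩
    · exact y.1.refl _
    · exact key s p hp q hq h
    · exact y.rel_neg_iff.1 (key s _ hp _ hq (x.rel_neg h))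
  · exact (hz _ _).2 (Or.inr ⟨false, by simp [B]⟩)
  · rw [hy]
    simp only [Set.mem_insert_iff, Set.mem_singleton_iff, pos_eq_iff]
    omega
  · intro w hxw hyw
    have hjk : w.1 j k := hyw ((hy _ _).2 (by simp))
    exact w.1.trans (hxw hij) (w.1.trans hjk (hxw hkl))

end NCB

/-! ### The shape of left modular elements. -/

namespace NCB

theorem exists_rep {n : ℕ} {i a : SignedSet n} (hi : pos i ≤ n) (h : a ≠ i) (h' : a ≠ i.neg) :
    ∃ a', (a' = a ∨ a' = a.neg) ∧ pos i < pos a' ∧ pos a' < pos i + n := by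
  have ni := pos_neg i
  have na := pos_neg a
  have bi := pos_bounds i
  have ba := pos_bounds a
  rw [Ne, pos_eq_iff] at h h'
  by_cases hc : pos i < pos a ∧ pos a < pos i + n
  · exact ⟨a, Or.inl rfl, hc⟩
  · exact ⟨a.neg, Or.inr rfl, by omega⟩

end NCB

open NCB

variable {n : ℕ} {x : NCB n}

/-- At most one pair `{a, -a}` is outside the zero block of a left modular element. -/
theorem IsLeftModular.eq_or_eq_neg_of_zero (hx : IsLeftModular x) {i a b : SignedSet n}
    (hi : x.1 i i.neg) (ha : ¬ x.1 a i) (hb : ¬ x.1 b i) : b = a ∨ b = a.neg := by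
  have core : ∀ i a b : SignedSet n, x.1 i i.neg → ¬ x.1 a i → ¬ x.1 b i → pos i ≤ n →
      pos i < pos a → pos a < pos b → pos b < pos i + n → False := by
    intro i a b hi ha hb hin h₁ h₂ h₃
    have ni := pos_neg i
    have na := pos_neg a
    have nb := pos_neg b
    have bb := pos_bounds b
    have hneg : ∀ c, ¬ x.1 c i → ¬ x.1 c.neg i := fun c hc h =>
      hc (x.1.trans (x.rel_neg_iff.1 (x.1.trans h hi)) (x.1.refl i))
    have hneg' : ∀ c, ¬ x.1 c i → ¬ x.1 c i.neg := fun c hc h => hc (x.1.trans h (x.1.symm hi))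
    -- The chord from `-b` to `a` separates `i` from `-i`. When `-b` is numbered after `a`, the
    -- half-turned picture is used instead.
    by_cases hbn : pos b ≤ n
    · refine not_isLeftModular_of_zero (i := i.neg) (k := b) (a := a.neg) ?_ (hneg' _ hb)
        (hneg' _ (hneg _ ha)) ?_ ?_ ?_ hx
      · rw [SignedSet.neg_neg]
        exact x.1.symm hi
      all_goals omega
    · exact not_isLeftModular_of_zero (k := b.neg) hi (hneg _ hb) ha (by omega) (by omega)
        (by omega) hx
  have core' : ∀ i a b : SignedSet n, x.1 i i.neg → ¬ x.1 a i → ¬ x.1 b i → pos i ≤ n →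
      b = a ∨ b = a.neg := by
    intro i a b hi ha hb hin
    have hne : ∀ c, ¬ x.1 c i → c ≠ i ∧ c ≠ i.neg := fun c hc =>
      ⟨fun h => hc (h ▸ x.1.refl _), fun h => hc (h ▸ x.1.symm hi)⟩
    have hneg : ∀ c c', ¬ x.1 c i → (c' = c ∨ c' = c.neg) → ¬ x.1 c' i := by
      rintro c c' hc (rfl | rfl) h
      · exact hc h
      · exact hc (x.rel_neg_iff.1 (x.1.trans h hi))
    obtain ⟨a', ha', h₁, h₂⟩ := exists_rep hin (hne a ha).1 (hne a ha).2
    obtain ⟨b', hb', h₃, h₄⟩ := exists_rep hin (hne b hb).1 (hne b hb).2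
    have h : a' = b' := by
      rcases lt_trichotomy (pos a') (pos b') with h | h | h
      · exact (core i a' b' hi (hneg _ _ ha ha') (hneg _ _ hb hb') hin h₁ h h₄).elim
      · exact eq_of_pos_eq h
      · exact (core i b' a' hi (hneg _ _ hb hb') (hneg _ _ ha ha') hin h₃ h h₂).elim
    rcases ha' with rfl | rfl <;> rcases hb' with h' | h'
    · exact Or.inl (h'.symm.trans h.symm)
    · exact Or.inr (neg_eq_iff.1 (h'.symm.trans h.symm))
    · exact Or.inr (h'.symm.trans h.symm)
    · exact Or.inl (by rw [← SignedSet.neg_neg b, ← h', ← h, SignedSet.neg_neg])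
  by_cases hin : pos i ≤ n
  · exact core' i a b hi ha hb hin
  · have := pos_neg i
    have := pos_bounds i
    refine core' i.neg a b (by rw [SignedSet.neg_neg]; exact x.1.symm hi) (fun h => ha ?_) (fun h => hb ?_)
      (by omega)
    · exact x.1.trans h (x.1.symm hi)
    · exact x.1.trans h (x.1.symm hi)

/-- The blocks of a left modular element without zero block have at most two elements. -/
theorem IsLeftModular.not_triple (hx : IsLeftModular x) (h0 : ∀ p, ¬ x.1 p p.neg)
    {i j k : SignedSet n} (hij : x.1 i j) (hik : x.1 i k) (h₁ : i ≠ j) (h₂ : i ≠ k) (h₃ : j ≠ k) :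
    False := by
  have core : ∀ i j k : SignedSet n, x.1 i j → x.1 i k → pos i < pos j → pos j < pos k →
      False := by
    intro i j k hij hik h₁ h₂
    have hjk := x.1.trans (x.1.symm hij) hik
    have ni := pos_neg i
    have nj := pos_neg j
    have nk := pos_neg k
    have bi := pos_bounds i
    have bk := pos_bounds k
    have hne : ∀ p q, x.1 p q → pos p ≠ pos q.neg := fun p q h h' =>
      h0 q (x.1.trans (x.1.symm h) (eq_of_pos_eq h' ▸ x.1.refl _))
    have e₁ := hne _ _ hij
    have e₂ := hne _ _ hik
    have e₃ := hne _ _ hjk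
    -- If the three points fit into a half of the polygon, they or their negatives, in a suitable
    -- cyclic order, form an excluded triple.
    by_cases c₁ : pos k < pos i + n
    · exact not_isLeftModular_of_triple h0 hij hjk h₁ h₂ c₁ hx
    by_cases c₂ : pos i + n < pos j
    · exact not_isLeftModular_of_triple h0 (x.rel_neg hjk) (x.rel_neg (x.1.symm hik))
        (by omega) (by omega) (by omega) hx
    by_cases c₃ : pos j + n < pos k
    · exact not_isLeftModular_of_triple h0 (x.rel_neg (x.1.symm hik)) (x.rel_neg hij)
        (by omega) (by omega) (by omega) hx
    -- Otherwise the triangle contains the centre and crosses its negative, which would make the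
    -- block a zero block.
    · exact h0 j (x.1.trans hjk (x.1.trans (x.1.symm hjk)
        (x.rel_of_crossing hjk (x.rel_neg hij |> x.1.symm) (by omega))))
  rw [Ne, pos_eq_iff] at h₁ h₂ h₃
  have hji := x.1.symm hij
  have hki := x.1.symm hik
  have hjk := x.1.trans hji hik
  have hkj := x.1.symm hjk
  rcases lt_or_gt_of_ne h₁ with h₁ | h₁ <;> rcases lt_or_gt_of_ne h₂ with h₂ | h₂ <;>
    rcases lt_or_gt_of_ne h₃ with h₃ | h₃
  · exact core i j k hij hik h₁ h₃
  · exact core i k j hik hij h₂ h₃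
  · omega
  · exact core k i j hki hkj h₂ h₁
  · exact core j i k hji hjk h₁ h₂
  · omega
  · exact core j k i hjk hji h₃ h₂
  · exact core k j i hkj hki h₃ h₁

/-- A left modular element without zero block has at most one pair `B`, `-B` of blocks that are
not singletons. -/
theorem IsLeftModular.pair_unique (hx : IsLeftModular x) (h0 : ∀ p, ¬ x.1 p p.neg)
    {p q u v : SignedSet n} (hpq : x.1 p q) (hne : p ≠ q) (huv : x.1 u v) (hne' : u ≠ v) :
    u = p ∧ v = q ∨ u = q ∧ v = p ∨ u = p.neg ∧ v = q.neg ∨ u = q.neg ∧ v = p.neg := by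
  have norm : ∀ p q : SignedSet n, x.1 p q → p ≠ q → ∃ i j : SignedSet n, x.1 i j ∧
      pos i < pos j ∧ pos j < pos i + n ∧ pos i ≤ n ∧
      (p = i ∧ q = j ∨ p = j ∧ q = i ∨ p = i.neg ∧ q = j.neg ∨ p = j.neg ∧ q = i.neg) := by
    intro p q h hne
    have np := pos_neg p
    have nq := pos_neg q
    have bp := pos_bounds p
    have bq := pos_bounds q
    have hne₂ : pos p ≠ pos q.neg := fun h' =>
      h0 q (x.1.trans (x.1.symm h) (eq_of_pos_eq h' ▸ x.1.refl _))
    rw [Ne, pos_eq_iff] at hne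
    by_cases c₁ : pos p < pos q ∧ pos q < pos p + n ∧ pos p ≤ n
    · exact ⟨p, q, h, c₁.1, c₁.2.1, c₁.2.2, by simp⟩
    by_cases c₂ : pos q < pos p ∧ pos p < pos q + n ∧ pos q ≤ n
    · exact ⟨q, p, x.1.symm h, c₂.1, c₂.2.1, c₂.2.2, by simp⟩
    by_cases c₃ : pos p.neg < pos q.neg ∧ pos q.neg < pos p.neg + n ∧ pos p.neg ≤ n
    · exact ⟨p.neg, q.neg, x.rel_neg h, c₃.1, c₃.2.1, c₃.2.2, by simp [SignedSet.neg_neg]⟩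
    · exact ⟨q.neg, p.neg, x.rel_neg (x.1.symm h), by omega, by omega, by omega,
        by simp [SignedSet.neg_neg]⟩
  obtain ⟨i, j, hij, h₁, h₂, h₃, he⟩ := norm p q hpq hne
  obtain ⟨k, l, hkl, h₄, h₅, h₆, he'⟩ := norm u v huv hne'
  suffices h : k = i ∧ l = j by
    obtain ⟨rfl, rfl⟩ := h
    rcases he with ⟨rfl, rfl⟩ | ⟨rfl, rfl⟩ | ⟨rfl, rfl⟩ | ⟨rfl, rfl⟩ <;>
    rcases he' with ⟨rfl, rfl⟩ | ⟨rfl, rfl⟩ | ⟨rfl, rfl⟩ | ⟨rfl, rfl⟩ <;> simp [SignedSet.neg_neg]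
  have ni := pos_neg i
  have nj := pos_neg j
  have nk := pos_neg k
  have nl := pos_neg l
  have bi := pos_bounds i
  have bj := pos_bounds j
  have bk := pos_bounds k
  have bl := pos_bounds l
  have hne : ∀ {p q : SignedSet n}, pos p ≠ pos q → p ≠ q := fun h h' => h (h' ▸ rfl)
  by_cases hik : x.1 i k
  · have hil := x.1.trans hik hkl
    have e₁ : k = i ∨ k = j := by
      by_contra! hc
      exact hx.not_triple h0 hij hik (hne h₁.ne) hc.1.symm hc.2.symm
    have e₂ : l = i ∨ l = j := by
      by_contra! hc
      exact hx.not_triple h0 hij hil (hne h₁.ne) hc.1.symm hc.2.symm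
    rcases e₁ with rfl | rfl <;> rcases e₂ with rfl | rfl
    · omega
    · simp
    · omega
    · omega
  by_cases hik' : x.1 i.neg k
  · exfalso
    have hij' := x.rel_neg hij
    have hil := x.1.trans hik' hkl
    have e₁ : k = i.neg ∨ k = j.neg := by
      by_contra! hc
      exact hx.not_triple h0 hij' hik' (hne (by omega)) hc.1.symm hc.2.symm
    have e₂ : l = i.neg ∨ l = j.neg := by
      by_contra! hc
      exact hx.not_triple h0 hij' hil (hne (by omega)) hc.1.symm hc.2.symm
    rw [pos_eq_iff, pos_eq_iff] at e₁ e₂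
    omega
  exfalso
  have hki : ¬ x.1 k i := fun h => hik (x.1.symm h)
  have hkin : ¬ x.1 k i.neg := fun h => hik' (x.1.symm h)
  have hikn : ¬ x.1 i k.neg := fun h => hik' (x.rel_neg_iff.1 (by rwa [SignedSet.neg_neg]))
  -- Nothing outside a pair's block lies between its two elements, so neither pair nests in or
  -- crosses the other or its negative. Two consecutive pairs within a half remain.
  have hb : ∀ m, ¬ x.1 i m → ¬ (pos i < pos m ∧ pos m < pos j) := fun m hm h =>
    not_isLeftModular_of_between h0 hij hm h.1 h.2 h₂ hx
  have hb' : ∀ m, ¬ x.1 k m → ¬ (pos k < pos m ∧ pos m < pos l) := fun m hm h =>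
    not_isLeftModular_of_between h0 hkl hm h.1 h.2 h₅ hx
  have a₁ := hb k hik
  have a₂ := hb l fun h => hik (x.1.trans h (x.1.symm hkl))
  have a₃ := hb k.neg hikn
  have a₄ := hb l.neg fun h => hikn (x.1.trans h (x.rel_neg (x.1.symm hkl)))
  have b₁ := hb' i hki
  have b₂ := hb' j fun h => hki (x.1.trans h (x.1.symm hij))
  have b₃ := hb' i.neg hkin
  have b₄ := hb' j.neg fun h => hkin (x.1.trans h (x.rel_neg (x.1.symm hij)))
  have d : ∀ p q, ¬ x.1 p q → pos p ≠ pos q := fun p q h h' =>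
    h (eq_of_pos_eq h' ▸ x.1.refl _)
  have d₁ := d i k hik
  have d₂ := d i l fun h => hik (x.1.trans h (x.1.symm hkl))
  have d₃ := d k j fun h => hki (x.1.trans h (x.1.symm hij))
  have d₄ := d k.neg j fun h => hikn (x.1.trans hij (x.1.symm h))
  have d₅ := d i.neg l fun h => hik' (x.1.trans h (x.1.symm hkl))
  rcases lt_or_gt_of_ne d₁ with h | h
  · exact not_isLeftModular_of_two_pairs hij hkl hik h₁ (by omega) h₄ (by omega) hx
  · exact not_isLeftModular_of_two_pairs hkl hij hki h₄ (by omega) h₁ (by omega) hx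

/-! ### Ranks, and the absence of M-chains for `n ≥ 4`. -/

theorem SignedSet.natCard (n : ℕ) : Nat.card (SignedSet n) = 2 * n := by
  rw [Nat.card_eq_fintype_card, Fintype.card_coe,
    Finset.card_erase_of_mem (by simp), Int.card_Icc]
  omega

/-- Away from `±v` distinct elements lie in distinct blocks, so there are at least `2n - 2` blocks.
-/
theorem NCB.rank_le_one (h : ∃ v, ∀ p q, x.1 p q → p ≠ v → p ≠ v.neg → q ≠ v → q ≠ v.neg → p = q) :
    x.rank ≤ 1 := by
  obtain ⟨v, hv⟩ := h
  have h₁ : ({v, v.neg}ᶜ : Set (SignedSet n)).ncard ≤ x.1.classes.ncard := by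
    refine Set.ncard_le_ncard_of_injOn (fun p => {q | x.1 q p}) (fun p _ => x.1.mem_classes p) ?_
      (Set.toFinite _)
    intro p hp q hq h
    simp only [Set.mem_compl_iff, Set.mem_insert_iff, Set.mem_singleton_iff, not_or] at hp hq
    refine hv p q ?_ hp.1 hp.2 hq.1 hq.2
    have h : {r | x.1 r p} = {r | x.1 r q} := h
    have : p ∈ {r | x.1 r q} := h ▸ x.1.refl p
    exact this
  have h₂ : ({v, v.neg} : Set (SignedSet n)).ncard ≤ 2 := (Set.ncard_insert_le _ _).trans (by simp)
  have h₃ := Set.ncard_compl ({v, v.neg} : Set (SignedSet n))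
  rw [SignedSet.natCard] at h₃
  unfold NCB.rank
  omega

/-- There are at most three blocks: those of `i`, `a` and `-a`. -/
theorem NCB.le_rank_of_zero {i : SignedSet n}
    (h : ∀ a b, ¬ x.1 a i → ¬ x.1 b i → b = a ∨ b = a.neg) : n - 1 ≤ x.rank := by
  obtain ⟨a, ha⟩ : ∃ a, ∀ b, ¬ x.1 b i → b = a ∨ b = a.neg := by
    by_cases h' : ∃ a, ¬ x.1 a i
    · exact h'.imp fun a ha b => h a b ha
    · push Not at h'
      exact ⟨i, fun b hb => (hb (h' b)).elim⟩
  have h₁ : x.1.classes ⊆ {{p | x.1 p i}, {p | x.1 p a}, {p | x.1 p a.neg}} := by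
    rintro _ ⟨b, rfl⟩
    by_cases hb : x.1 b i
    · refine Or.inl ?_
      ext p
      exact ⟨fun h => x.1.trans h hb, fun h => x.1.trans h (x.1.symm hb)⟩
    · rcases ha b hb with rfl | rfl <;> simp
  have h₂ := Set.ncard_le_ncard h₁
  have h₃ := Set.ncard_insert_le {p | x.1 p i} {{p | x.1 p a}, {p | x.1 p a.neg}}
  have h₄ := Set.ncard_insert_le {p | x.1 p a} {{p | x.1 p a.neg}}
  rw [Set.ncard_singleton] at h₄
  unfold NCB.rank
  omega

theorem IsLeftModular.exists_pair (hx : IsLeftModular x) (h0 : ∀ p, ¬ x.1 p p.neg)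
    (i : SignedSet n) : ∃ u v, x.1 u v ∧ (u = v → u = i) ∧ ∀ p q, x.1 p q → p ≠ q →
      p = u ∧ q = v ∨ p = v ∧ q = u ∨ p = u.neg ∧ q = v.neg ∨ p = v.neg ∧ q = u.neg := by
  by_cases h : ∃ u v, x.1 u v ∧ u ≠ v
  · obtain ⟨u, v, huv, hne⟩ := h
    exact ⟨u, v, huv, fun h => (hne h).elim, fun p q hpq hne' =>
      hx.pair_unique h0 huv hne hpq hne'⟩
  · push Not at h
    -- For the discrete partition the degenerate pair `(i, i)` is used, so that later `{±i}` serves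
    -- as the zero block.
    exact ⟨i, i, x.1.refl i, fun _ => rfl, fun p q hpq hne => (hne (h p q hpq)).elim⟩

theorem IsLeftModular.rank_ne_two (hn : 4 ≤ n) (hx : IsLeftModular x) : x.rank ≠ 2 := by
  by_cases h0 : ∃ i, x.1 i i.neg
  · obtain ⟨i, hi⟩ := h0
    have := le_rank_of_zero (x := x) (i := i) fun a b => hx.eq_or_eq_neg_of_zero hi
    omega
  · push Not at h0
    have : 0 < Nat.card (SignedSet n) := by rw [SignedSet.natCard]; omega
    obtain ⟨i⟩ := (Nat.card_pos_iff.1 this).1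
    obtain ⟨u, v, -, -, h⟩ := hx.exists_pair h0 i
    have := rank_le_one (x := x) ⟨v, fun p q hpq h₁ h₂ h₃ h₄ => by
      by_contra hne
      have := h p q hpq hne
      tauto⟩
    omega

theorem NCB.not_isMChain (hn : 4 ≤ n) (d : Set (NCB n)) : ¬ IsMChain d := by
  intro hd
  have hlm : ∀ e ∈ d, IsLeftModular e := fun e he => hd.isLeftModular he
  have hpos : 0 < Nat.card (SignedSet n) := by rw [SignedSet.natCard]; omega
  obtain ⟨i₀⟩ := (Nat.card_pos_iff.1 hpos).1
  -- By maximality, anything comparable with every member of `d` belongs to `d`.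
  have hmem : ∀ w : NCB n, (∀ e ∈ d, e ≤ w ∨ w ≤ e) → w ∈ d := fun w hw => by
    have hc : IsChain (· ≤ ·) (insert w d) := hd.1.1.insert fun e he _ => (hw e he).symm
    rw [hd.1.2 hc (Set.subset_insert _ _)]
    exact Set.mem_insert _ _
  have hbot : (⊥ : NCB n) ∈ d := hmem ⊥ fun _ _ => Or.inr bot_le
  have htop : (⊤ : NCB n) ∈ d := hmem ⊤ fun _ _ => Or.inl le_top
  let top' : NCB n := zeroBlock Set.univ fun _ _ => Set.mem_univ _
  have htop' : (⊤ : NCB n).1 i₀ i₀.neg :=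
    le_iff.1 (le_top : top' ≤ ⊤) _ _ (zeroBlock_rel.2 (Or.inr ⟨trivial, trivial⟩))
  let bot' : NCB n := zeroBlock ∅ fun _ h => h
  have hbot' : ∀ i, ¬ (⊥ : NCB n).1 i i.neg := fun i h => by
    rcases zeroBlock_rel.1 (le_iff.1 (bot_le : ⊥ ≤ bot') _ _ h) with h | h
    · exact neg_ne i h.symm
    · exact h.1
  obtain ⟨u, ⟨hud, hu0⟩, humax⟩ := (Set.toFinite {e | e ∈ d ∧ ∀ i, ¬ e.1 i i.neg}).exists_maximal
    ⟨⊥, hbot, hbot'⟩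
  obtain ⟨v, ⟨hvd, hv0⟩, hvmin⟩ := (Set.toFinite {e | e ∈ d ∧ ∃ i, e.1 i i.neg}).exists_minimal
    ⟨⊤, htop, i₀, htop'⟩
  have huv : u ≤ v := by
    rcases hd.1.1.total hud hvd with h | h
    · exact h
    · obtain ⟨i, hi⟩ := hv0
      exact (hu0 i (le_iff.1 h _ _ hi)).elim
  obtain ⟨i, hi⟩ := hv0
  obtain ⟨p, q, hpq, hpqi, huniq⟩ := (hlm u hud).exists_pair hu0 i
  have hvpq := le_iff.1 huv _ _ hpq
  have hpi : v.1 p i := by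
    -- Were `p` and `q` outside the zero block of `v`, they would be equal or opposite. Equality
    -- means `p = i`, and opposite elements would give `u` a zero block.
    by_contra hp
    have hq : ¬ v.1 q i := fun h => hp (v.1.trans hvpq h)
    rcases (hlm v hvd).eq_or_eq_neg_of_zero hi hp hq with rfl | rfl
    · rw [hpqi rfl] at hp
      exact hp (v.1.refl i)
    · exact hu0 p hpq
  have hqi : v.1 q i := v.1.trans (v.1.symm hvpq) hpi
  have hneg : ∀ a, v.1 a i → v.1 a.neg i := fun a h =>
    v.1.trans (v.rel_neg h) (v.1.symm hi)
  let w : NCB n := zeroBlock {p, p.neg, q, q.neg}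
    (by rintro a (rfl | rfl | rfl | rfl) <;> simp [SignedSet.neg_neg])
  have hw : ∀ a b, w.1 a b ↔ _ := fun a b => zeroBlock_rel
  have huw : u ≤ w := le_iff.2 fun a b hab => by
    by_cases hne : a = b
    · exact hne ▸ w.1.refl a
    · rw [hw]
      rcases huniq a b hab hne with ⟨rfl, rfl⟩ | ⟨rfl, rfl⟩ | ⟨rfl, rfl⟩ | ⟨rfl, rfl⟩ <;> simp
  have hwv : w ≤ v := le_iff.2 fun a b hab => by
    have hS : ∀ a ∈ ({p, p.neg, q, q.neg} : Set (SignedSet n)), v.1 a i := by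
      rintro a (rfl | rfl | rfl | rfl)
      exacts [hpi, hneg _ hpi, hqi, hneg _ hqi]
    rcases (hw a b).1 hab with rfl | ⟨ha, hb⟩
    · exact v.1.refl a
    · exact v.1.trans (hS a ha) (v.1.symm (hS b hb))
  have hwd : w ∈ d := hmem w fun e he => by
    by_cases h0 : ∃ i, e.1 i i.neg
    · refine Or.inr (hwv.trans ?_)
      rcases hd.1.1.total hvd he with h | h
      · exact h
      · exact hvmin ⟨he, h0⟩ h
    · push Not at h0
      refine Or.inl (le_trans ?_ huw)
      rcases hd.1.1.total hud he with h | h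
      · exact humax ⟨he, h0⟩ h
      · exact h
  -- There are `2n ≥ 8` vertices, so two pairs can be found outside the four elements of the zero
  -- block.
  have hex : ∀ S : Finset (SignedSet n), S.card ≤ 6 → ∃ a, a ∉ S := by
    intro S hS
    by_contra! h
    have : Nat.card (SignedSet n) = S.card := by
      rw [Nat.card_eq_fintype_card, ← Finset.card_univ, Finset.eq_univ_of_forall h]
    rw [SignedSet.natCard] at this
    omega
  obtain ⟨a, ha⟩ := hex {p, p.neg, q, q.neg} (Finset.card_le_four.trans (by norm_num))
  obtain ⟨b, hb⟩ := hex {p, p.neg, q, q.neg, a, a.neg} Finset.card_le_six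
  simp only [Finset.mem_insert, Finset.mem_singleton, not_or] at ha hb
  have hna : ¬ w.1 a p := by
    rw [hw]
    simp [ha]
  have hnb : ¬ w.1 b p := by
    rw [hw]
    simp [hb]
  rcases (hlm w hwd).eq_or_eq_neg_of_zero ((hw _ _).2 (by simp)) hna hnb with h | h
  · exact hb.2.2.2.2.1 h
  · exact hb.2.2.2.2.2 h

/-! ### The case `n ≤ 2`. -/

theorem NCB.eq_top_of_rel {n : ℕ} (hn : n ≤ 2) {v : NCB n} {p q : SignedSet n} (h₁ : q ≠ p)
    (h₂ : q ≠ p.neg) (hpq : v.1 p q) (hp : v.1 p p.neg) : v = ⊤ := by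
  refine top_le_iff.1 (le_iff.2 fun a b _ => ?_)
  have key : ∀ a, v.1 p a := by
    intro a
    have h : a = p ∨ a = p.neg ∨ a = q ∨ a = q.neg := by
      have bp := pos_bounds p
      have bq := pos_bounds q
      have ba := pos_bounds a
      have np := pos_neg p
      have nq := pos_neg q
      rw [Ne, pos_eq_iff] at h₁ h₂
      simp only [pos_eq_iff]
      omega
    rcases h with rfl | rfl | rfl | rfl
    exacts [v.1.refl _, hp, hpq, v.1.trans hp (v.rel_neg hpq)]
  exact v.1.trans (v.1.symm (key a)) (key b)

theorem NCB.eq_bot_or_eq_top {n : ℕ} (hn : n ≤ 2) (u v : NCB n) (huv : u < v) :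
    u = ⊥ ∨ v = ⊤ := by
  by_cases h : ∃ p q, u.1 p q ∧ p ≠ q
  · right
    obtain ⟨p, q, hpq, hne⟩ := h
    obtain ⟨r, s, hrs, hrs'⟩ : ∃ r s, v.1 r s ∧ ¬ u.1 r s := by
      by_contra! h
      exact huv.not_ge (le_iff.2 h)
    have hv := le_iff.1 huv.le _ _ hpq
    have hne' : r ≠ s := fun h => hrs' (h ▸ u.1.refl r)
    by_cases hq : q = p.neg
    · subst hq
      -- A further relation either meets the zero block `{±p}` or creates a second one, which must
      -- coincide with it.
      have key : ∀ r s, v.1 r s → r ≠ s → r ≠ p → r ≠ p.neg → v = ⊤ := by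
        intro r s hrs hne h₁ h₂
        refine eq_top_of_rel hn h₁ h₂ ?_ hv
        have h : s = p ∨ s = p.neg ∨ s = r.neg := by
          have bp := pos_bounds p
          have br := pos_bounds r
          have bs := pos_bounds s
          have np := pos_neg p
          have nr := pos_neg r
          rw [Ne, pos_eq_iff] at hne h₁ h₂
          simp only [pos_eq_iff]
          omega
        rcases h with rfl | rfl | rfl
        · exact v.1.symm hrs
        · exact v.1.trans hv (v.1.symm hrs)
        · exact v.rel_of_zero hv hrs
      by_cases h₁ : r = p ∨ r = p.neg
      · by_cases h₂ : s = p ∨ s = p.neg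
        · exfalso
          rcases h₁ with rfl | rfl <;> rcases h₂ with rfl | rfl
          exacts [hne' rfl, hrs' hpq, hrs' (u.1.symm hpq), hne' rfl]
        · exact key s r (v.1.symm hrs) hne'.symm (fun h => h₂ (Or.inl h)) fun h => h₂ (Or.inr h)
      · exact key r s hrs hne' (fun h => h₁ (Or.inl h)) fun h => h₁ (Or.inr h)
    · refine eq_top_of_rel hn hne.symm hq hv ?_
      -- The elements `±p, ±q` exhaust the polygon, so any relation of `v` beyond those of `u`
      -- produces a zero block.
      have cover : ∀ a, a = p ∨ a = p.neg ∨ a = q ∨ a = q.neg := by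
        intro a
        have bp := pos_bounds p
        have bq := pos_bounds q
        have ba := pos_bounds a
        have np := pos_neg p
        have nq := pos_neg q
        rw [Ne, pos_eq_iff] at hne
        rw [pos_eq_iff] at hq
        simp only [pos_eq_iff]
        omega
      have hn₁ := u.rel_neg hpq
      have hn₂ := v.rel_neg hv
      have e₁ : v.1 p q.neg → v.1 p p.neg := fun h => v.1.trans h (v.1.symm hn₂)
      have e₂ : v.1 q q.neg → v.1 p p.neg := fun h => e₁ (v.1.trans hv h)
      have e₃ : v.1 q p.neg → v.1 p p.neg := fun h => v.1.trans hv h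
      rcases cover r with rfl | rfl | rfl | rfl <;> rcases cover s with rfl | rfl | rfl | rfl
      all_goals first
        | exact absurd rfl hne'
        | exact hrs
        | exact v.1.symm hrs
        | exact absurd hpq hrs'
        | exact absurd (u.1.symm hpq) hrs'
        | exact absurd hn₁ hrs'
        | exact absurd (u.1.symm hn₁) hrs'
        | exact e₁ hrs
        | exact e₁ (v.1.symm hrs)
        | exact e₂ hrs
        | exact e₂ (v.1.symm hrs)
        | exact e₃ hrs
        | exact e₃ (v.1.symm hrs)
  · left
    push Not at h
    exact le_bot_iff.1 (le_iff.2 fun a b hab => h a b hab ▸ (⊥ : NCB n).1.refl a)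

/-! ### The case `n = 3`: partitions encoded as sets of chords. -/

/-- The vertices of the hexagon. -/
def vertex (i : Fin 6) : SignedSet 3 :=
  ⟨if i.1 < 3 then (i.1 : ℤ) + 1 else 2 - i.1, by revert i; decide⟩

theorem vertex_bijective : Function.Bijective vertex := by
  constructor
  · intro i j h
    have h := congrArg Subtype.val h
    revert i j
    decide
  · rintro ⟨a, ha⟩
    have : a ≠ 0 ∧ -3 ≤ a ∧ a ≤ 3 := abs_bound ⟨a, ha⟩
    by_cases h : 0 < a
    · refine ⟨⟨(a - 1).toNat, by omega⟩, Subtype.ext ?_⟩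
      simp only [vertex]
      split_ifs <;> omega
    · refine ⟨⟨(2 - a).toNat, by omega⟩, Subtype.ext ?_⟩
      simp only [vertex]
      split_ifs <;> omega

theorem neg_vertex (i : Fin 6) : (vertex i).neg = vertex (i + 3) := by
  apply Subtype.ext
  revert i
  decide

theorem pos_vertex (i : Fin 6) : pos (vertex i) = i.1 + 1 := by
  revert i
  decide

/-- The sides and diagonals of the hexagon, up to central symmetry, are numbered from `0` to `8`. -/
def chord (i j : Fin 6) : ℕ :=
  match (j - i).1 with
  | 1 => i.1 % 3
  | 5 => j.1 % 3
  | 2 => 3 + i.1 % 3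
  | 4 => 3 + j.1 % 3
  -- This also catches `i = j`, harmlessly: `chordRel` holds there in any case.
  | _ => 6 + i.1 % 3

/-- A set of chords of the hexagon, given by the bits of `N`, regarded as a relation. -/
def chordRel (N : ℕ) (i j : Fin 6) : Bool := i == j || N.testBit (chord i j)

/-- The sets of chords that define non-crossing `B₃`-partitions. -/
def chordSets : List ℕ :=
  [0, 1, 2, 4, 8, 11, 16, 22, 32, 37, 64, 66, 128, 132, 209, 256, 257, 332, 418, 511]

-- Symmetry and invariance under negation need not be assumed, since `chord` is numbered up to both.
set_option synthInstance.maxSize 1000 in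
set_option synthInstance.maxHeartbeats 200000 in
theorem mem_chordSets : ∀ N ∈ List.range 512,
    (∀ i j, chordRel N i j → ∀ k, chordRel N j k → chordRel N i k) →
    (∀ i, chordRel N i (i + 3) → ∀ j, chordRel N j (j + 3) → chordRel N i j) →
    (∀ a c, chordRel N a c → ∀ b, a < b → b < c → ∀ d, c < d → chordRel N b d → chordRel N a b) →
    N ∈ chordSets := by
  decide +kernel

theorem chordRel_symm : ∀ N ∈ chordSets, ∀ i j, chordRel N i j → chordRel N j i := by
  decide +kernel

theorem chordRel_trans : ∀ N ∈ chordSets, ∀ i j, chordRel N i j → ∀ k, chordRel N j k →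
    chordRel N i k := by
  decide +kernel

theorem chordRel_neg : ∀ N ∈ chordSets, ∀ i j, chordRel N i j → chordRel N (i + 3) (j + 3) := by
  decide +kernel

theorem chordRel_zero : ∀ N ∈ chordSets, ∀ i, chordRel N i (i + 3) → ∀ j, chordRel N j (j + 3) →
    chordRel N i j := by
  decide +kernel

theorem chordRel_nonCrossing : ∀ N ∈ chordSets, ∀ a c, chordRel N a c → ∀ b, a < b → b < c →
    ∀ d, c < d → chordRel N b d → chordRel N a b := by
  decide +kernel

/-- The labelling of the vertices of the hexagon. -/
noncomputable def vertexEquiv : Fin 6 ≃ SignedSet 3 := Equiv.ofBijective vertex vertex_bijective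

theorem vertexEquiv_symm_neg (a : SignedSet 3) :
    vertexEquiv.symm a.neg = vertexEquiv.symm a + 3 := by
  obtain ⟨i, rfl⟩ := vertexEquiv.surjective a
  rw [Equiv.symm_apply_apply, Equiv.symm_apply_eq]
  exact neg_vertex i

theorem vertexEquiv_symm_lt {a b : SignedSet 3} (h : pos a < pos b) :
    vertexEquiv.symm a < vertexEquiv.symm b := by
  obtain ⟨i, rfl⟩ := vertexEquiv.surjective a
  obtain ⟨j, rfl⟩ := vertexEquiv.surjective b
  have hi : pos (vertexEquiv i) = i.1 + 1 := pos_vertex i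
  have hj : pos (vertexEquiv j) = j.1 + 1 := pos_vertex j
  rw [Equiv.symm_apply_apply, Equiv.symm_apply_apply, Fin.lt_def]
  omega

/-- The non-crossing `B₃`-partition given by a set of chords. -/
noncomputable def ofChords (N : ℕ) (hN : N ∈ chordSets) : NCB 3 :=
  ⟨{ r := fun a b => chordRel N (vertexEquiv.symm a) (vertexEquiv.symm b)
     iseqv := ⟨fun a => by simp [chordRel], fun h => chordRel_symm N hN _ _ h,
      fun h h' => chordRel_trans N hN _ _ h _ h'⟩ }, by
    rw [isBPartition_iff, isNonCrossing_iff]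
    refine ⟨⟨fun a b h => ?_, fun a b ha hb => ?_⟩, fun a b c d hab hbc hcd hac hbd => ?_⟩
    · change chordRel N _ _ = true
      rw [vertexEquiv_symm_neg, vertexEquiv_symm_neg]
      exact chordRel_neg N hN _ _ h
    · change chordRel N _ _ = true at ha hb
      rw [vertexEquiv_symm_neg] at ha hb
      exact chordRel_zero N hN _ ha _ hb
    · exact chordRel_nonCrossing N hN _ _ hac _ (vertexEquiv_symm_lt hab)
        (vertexEquiv_symm_lt hbc) _ (vertexEquiv_symm_lt hcd) hbd⟩

theorem ofChords_rel {N : ℕ} {hN : N ∈ chordSets} {i j : Fin 6} :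
    (ofChords N hN).1 (vertex i) (vertex j) ↔ chordRel N i j := by
  change chordRel N (vertexEquiv.symm (vertexEquiv i)) (vertexEquiv.symm (vertexEquiv j)) ↔ _
  rw [Equiv.symm_apply_apply, Equiv.symm_apply_apply]

theorem NCB.le_iff_vertex {u v : NCB 3} :
    u ≤ v ↔ ∀ i j, u.1 (vertex i) (vertex j) → v.1 (vertex i) (vertex j) := by
  refine ⟨fun h i j => le_iff.1 h _ _, fun h => le_iff.2 fun a b => ?_⟩
  obtain ⟨i, rfl⟩ := vertex_bijective.2 a
  obtain ⟨j, rfl⟩ := vertex_bijective.2 b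
  exact h i j

theorem exists_eq_ofChords (w : NCB 3) : ∃ N, ∃ hN : N ∈ chordSets, w = ofChords N hN := by
  classical
  let e : Fin 9 → Fin 6 × Fin 6 :=
    ![(0, 1), (1, 2), (2, 3), (0, 2), (1, 3), (2, 4), (0, 3), (1, 4), (2, 5)]
  let f : Fin 9 → Bool := fun k => decide (w.1 (vertex (e k).1) (vertex (e k).2))
  have hchord : ∀ i j, i ≠ j → ∃ k : Fin 9, chord i j = k ∧ (e k = (i, j) ∨ e k = (j, i) ∨
      e k = (i + 3, j + 3) ∨ e k = (j + 3, i + 3)) := by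
    decide +kernel
  have hrel : ∀ i j, chordRel (Nat.ofBits f) i j ↔ w.1 (vertex i) (vertex j) := by
    intro i j
    by_cases hij : i = j
    · subst hij
      simp [chordRel]
    · obtain ⟨k, hk, he⟩ := hchord i j hij
      have hn : w.1 (vertex (i + 3)) (vertex (j + 3)) ↔ w.1 (vertex i) (vertex j) := by
        rw [← neg_vertex, ← neg_vertex, w.rel_neg_iff]
      have hs : ∀ a b, w.1 a b ↔ w.1 b a := fun a b => ⟨w.1.symm, w.1.symm⟩
      have : chordRel (Nat.ofBits f) i j = f k := by
        simp [chordRel, hij, hk, Nat.testBit_ofBits_lt]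
      rw [this]
      simp only [f, decide_eq_true_eq]
      rcases he with he | he | he | he <;> rw [he]
      · exact hs _ _
      · exact hn
      · exact (hs _ _).trans hn
  have hN : Nat.ofBits f ∈ chordSets := by
    refine mem_chordSets _ (List.mem_range.2 (Nat.ofBits_lt_two_pow f)) ?_ ?_ ?_
    · intro i j hij k hjk
      rw [hrel] at *
      exact w.1.trans hij hjk
    · intro i hi j hj
      rw [hrel, ← neg_vertex] at hi hj
      rw [hrel]
      exact w.rel_of_zero hi hj
    · intro a c hac b hab hbc d hcd hbd
      rw [hrel] at *
      refine w.rel_of_crossing hac hbd (Or.inl ?_)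
      simp only [pos_vertex]
      omega
  refine ⟨_, hN, le_antisymm (le_iff_vertex.2 fun i j => ?_) (le_iff_vertex.2 fun i j => ?_)⟩
  · rw [ofChords_rel, hrel]
    exact id
  · rw [ofChords_rel, hrel]
    exact id

theorem land_eq_iff : ∀ N ∈ chordSets, ∀ M ∈ chordSets,
    (∀ i j, chordRel N i j → chordRel M i j) ↔ N &&& M = N := by
  decide +kernel

theorem ofChords_le {N M : ℕ} {hN : N ∈ chordSets} {hM : M ∈ chordSets} :
    ofChords N hN ≤ ofChords M hM ↔ N &&& M = N := by
  rw [← land_eq_iff N hN M hM, le_iff_vertex]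
  simp only [ofChords_rel]

theorem land_mem : ∀ N ∈ chordSets, ∀ M ∈ chordSets, N &&& M ∈ chordSets := by
  decide +kernel

theorem ofChords_inf {N M : ℕ} (hN : N ∈ chordSets) (hM : M ∈ chordSets) :
    ofChords N hN ⊓ ofChords M hM = ofChords (N &&& M) (land_mem N hN M hM) := by
  refine le_antisymm ?_ (le_inf (ofChords_le.2 ?_) (ofChords_le.2 ?_))
  · rw [le_iff_vertex]
    intro i j h
    rw [inf_rel, ofChords_rel, ofChords_rel] at h
    rw [ofChords_rel]
    simp only [chordRel, Bool.or_eq_true, Nat.testBit_land, Bool.and_eq_true] at h ⊢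
    tauto
  · rw [Nat.and_right_comm, Nat.and_self]
  · rw [Nat.and_assoc, Nat.and_self]

/-- The set of chords that defines the join of two partitions. -/
def chordJoin (N M : ℕ) : ℕ :=
  -- The intersection of all common upper bounds, starting from `511`, all nine chords, which is the
  -- top element.
  chordSets.foldr (fun C r => if N &&& C = N ∧ M &&& C = M then C &&& r else r) 511

theorem chordJoin_spec : ∀ N ∈ chordSets, ∀ M ∈ chordSets, chordJoin N M ∈ chordSets ∧
    N &&& chordJoin N M = N ∧ M &&& chordJoin N M = M ∧
    ∀ C ∈ chordSets, N &&& C = N → M &&& C = M → chordJoin N M &&& C = chordJoin N M := by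
  decide +kernel

theorem ofChords_sup {N M : ℕ} (hN : N ∈ chordSets) (hM : M ∈ chordSets) :
    ofChords N hN ⊔ ofChords M hM = ofChords (chordJoin N M) (chordJoin_spec N hN M hM).1 := by
  obtain ⟨h, h₁, h₂, h₃⟩ := chordJoin_spec N hN M hM
  refine le_antisymm (sup_le (ofChords_le.2 h₁) (ofChords_le.2 h₂)) ?_
  obtain ⟨C, hC, h'⟩ := exists_eq_ofChords (ofChords N hN ⊔ ofChords M hM)
  rw [h', ofChords_le]
  exact h₃ C hC (ofChords_le.1 (h' ▸ le_sup_left)) (ofChords_le.1 (h' ▸ le_sup_right))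

/-- The inequality of `distributive_latticeClosure`, with `≤` read as inclusion of bit sets. -/
theorem chordSets_supersolvable : ∀ N₁ ∈ chordSets, ∀ N₂ ∈ chordSets, N₂ &&& N₁ = N₂ →
    ∀ N₃ ∈ chordSets, N₃ &&& N₂ = N₃ →
    N₁ &&& chordJoin 1 N₂ &&& chordJoin 209 N₃ &&&
      chordJoin (chordJoin (1 &&& N₁) (209 &&& N₂)) N₃ =
    N₁ &&& chordJoin 1 N₂ &&& chordJoin 209 N₃ := by
  decide +kernel

theorem ofChords_wcovBy {N M : ℕ} (hN : N ∈ chordSets) (hM : M ∈ chordSets)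
    (h : N &&& M = N ∧ ∀ C ∈ chordSets, N &&& C = N → C &&& M = C → C = N ∨ C = M) :
    ofChords N hN ⩿ ofChords M hM := by
  refine ⟨ofChords_le.2 h.1, fun c hc hc' => ?_⟩
  obtain ⟨C, hC, rfl⟩ := exists_eq_ofChords c
  rcases h.2 C hC (ofChords_le.1 hc.le) (ofChords_le.1 hc'.le) with rfl | rfl
  · exact hc.false
  · exact hc'.false

theorem NCB.isSupersolvable_three : IsSupersolvable (NCB 3) := by
  have h0 : (⊥ : NCB 3) = ofChords 0 (by decide) := by
    obtain ⟨N, hN, h⟩ := exists_eq_ofChords ⊥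
    exact bot_le.antisymm (h ▸ ofChords_le.2 (Nat.zero_and N))
  have h1 : (⊤ : NCB 3) = ofChords 511 (by decide) := by
    obtain ⟨N, hN, h⟩ := exists_eq_ofChords ⊤
    have key : ∀ N ∈ chordSets, N &&& 511 = N := by decide
    exact le_antisymm (h ▸ ofChords_le.2 (key N hN)) le_top
  -- The set `1` gives the blocks `±{1, 2}`, and `209 = 1 + 16 + 64 + 128` the zero block `{±1,
  -- ±2}`, which misses only the pair `±3`.
  refine isSupersolvable_of_wcovBy (a := ofChords 1 (by decide)) (x := ofChords 209 (by decide))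
    (by rw [h0]; exact ofChords_wcovBy _ _ (by decide)) (ofChords_wcovBy _ _ (by decide))
    (by rw [h1]; exact ofChords_wcovBy _ _ (by decide)) fun y₁ y₂ y₃ h₃₂ h₂₁ => ?_
  obtain ⟨N₁, h₁, rfl⟩ := exists_eq_ofChords y₁
  obtain ⟨N₂, h₂, rfl⟩ := exists_eq_ofChords y₂
  obtain ⟨N₃, h₃, rfl⟩ := exists_eq_ofChords y₃
  simp only [ofChords_sup, ofChords_inf, ofChords_le] at h₃₂ h₂₁ ⊢
  exact chordSets_supersolvable N₁ h₁ N₂ h₂ h₂₁ N₃ h₃ h₃₂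

end NonCrossingB

theorem mainTheorem4 (n : ℕ) :
    (NonCrossingB.IsSupersolvable (NonCrossingB.NCB n) ↔ n ≤ 3) ∧
    (4 ≤ n →
      (∀ x : NonCrossingB.NCB n, x.rank = 2 → ¬ NonCrossingB.IsLeftModular x) ∧
      ¬ ∃ d : Set (NonCrossingB.NCB n), NonCrossingB.IsMChain d) := by
  refine ⟨⟨fun ⟨d, hd⟩ => ?_, fun hn => ?_⟩, fun hn =>
    ⟨fun x hx hx' => NonCrossingB.IsLeftModular.rank_ne_two hn hx' hx,
      fun ⟨d, hd⟩ => NonCrossingB.NCB.not_isMChain hn d hd⟩⟩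
  · by_contra hn
    exact NonCrossingB.NCB.not_isMChain (by omega) d hd
  · rcases hn.eq_or_lt with rfl | hn
    · exact NonCrossingB.NCB.isSupersolvable_three
    · exact NonCrossingB.isSupersolvable_of_length_le_two
        (NonCrossingB.NCB.eq_bot_or_eq_top (by omega))
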